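/- **Setting.** Let $\rho$ be a probability distribution on $[0,1]^d\times\{-1,1\}$, $(X,Y)\sim\rho$, $\eta(x)=\mathbb E[Y\mid X=x]$, and let $(x_i,y_i)_{i\ge1}$ be i.i.d. with law $\rho$. For an architecture $\mathbf a=(a_0,\dots,a_L)$ of positive integers with $a_0=d$, $a_L=1$, depth $L$ and width $\max_l a_l$, let $f(\cdot;\theta)$ be the ReLU network with weights and biases $\theta$, its output clipped to $[-1,1]$; $|\theta|_\infty$ is the largest absolute value of an entry of $\theta$ and $\mathcal P_{\mathbf a,R}=\{\theta:|\theta|_\infty\le R\}$. Fix $0<p<\infty$ and put $$\mathcal R_{\ell,\lambda}(\theta)=\mathbb E(f(X;\theta)-Y)^2+\tfrac\lambda2|\theta|_p^p,\qquad \widehat{\mathcal R}_{\ell,\lambda}(\theta)=\tfrac1n\sum_{i\le n}(f(x_i;\theta)-y_i)^2+\tfrac\lambda2|\theta|_p^p .$$ A minimum-norm solution $\widehat\theta_\lambda$ over $\mathcal P_{\mathbf a,R}$ is an element of smallest $|\cdot|_\infty$ among the minimizers of $\widehat{\mathcal R}_{\ell,\lambda}$ over $\mathcal P_{\mathbf a,R}$.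 The misclassification risk is $\mathcal R(c)=\mathbb P(c(X)\ne Y)$, $\mathcal R^*=\mathcal R(\operatorname{sign}\eta)$, with $\operatorname{sign}0=0$; the excess risk of $\widehat\theta_\lambda$ is $\mathbb E[\mathcal R(\operatorname{sign}f(\cdot;\widehat\theta_\lambda))]-\mathcal R^*$, the expectation being over the sample. **Assumptions.** (A3) for $(\mathbf a,R,\lambda)$ with constants $K>0$, $r>1$: for every $t>0$, every $\theta\in\mathcal P_{\mathbf a,R}$ at $\ell_\infty$-distance at least $t$ from the minimizers of $\mathcal R_{\ell,\lambda}$ over $\mathcal P_{\mathbf a,R}$ satisfies $\mathcal R_{\ell,\lambda}(\theta)\ge\min_{\mathcal P_{\mathbf a,R}}\mathcal R_{\ell,\lambda}+Kt^r$. (A4) for $\mathbf a$ with a finite constant $R^*>0$: among all parametrizations, $\mathcal R_{\ell,0}$ has a minimizer and, almost surely, for every sample size $n\ge1$, $\widehat{\mathcal R}_{\ell,0}$ has a minimizer and all its minimizers of smallest $|\cdot|_\infty$ satisfy $|\theta|_\infty\le R^*$. (A5) with an integer $s\ge1$: $\eta\in\mathcal C^s([0,1]^d)$ and for all integers $W_0,L_0\ge2$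 some network $f$ of width $\lceil C_1W_0\log_2W_0\rceil$ and depth $\lceil C_2L_0\log_2L_0\rceil+2d$ satisfies $\sup_{[0,1]^d}|f-\eta|\le C_3W_0^{-2s/d}L_0^{-2s/d}$, where $C_1=(3s)^dd$, $C_2=\sqrt s$, $C_3=s^d8^s\|\eta\|_{\mathcal C^s}$. **Statement.** Let $r>1$, $\alpha>0$, $L_0\ge2$ be fixed, assume (A5) with $\|\eta\|_{\mathcal C^s}>0$, and put $$W_{0,n}=\max\{2,\lceil L_0^{-1}(n^{-\alpha/r}/C_3)^{-d/2s}\rceil\},\quad W_n=\lceil C_1W_{0,n}\log_2W_{0,n}\rceil,\quad L_n=\lceil C_2L_0\log_2L_0\rceil+2d,\quad R_n=R^*[L_n(W_n^2+W_n)]^{1/p}.$$ Then, for a constant $\bar\lambda>0$ depending only on $p$, $$R_n=\tilde{\mathcal O}(n^{\alpha d/ps}),\qquad \bar\lambda n^{-2\alpha/r}R_n^{-2p}=\tilde{\mathcal O}(n^{-2\alpha(s+d)/(rs)}),$$ where $\tilde{\mathcal O}$ hides logarithmic factors. For every $n\ge1$ there is an architecture $\mathbf a_n$ of width $W_n$ and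 depth $L_n$ that contains a network $f$ with $\sup_{[0,1]^d}|f-\eta|\le n^{-\alpha/r}$. For every $n\ge 1$, every such $\mathbf a_n$ that satisfies (A4) with $R^*$, every $0\le\lambda\le\bar\lambda n^{-2\alpha/r}R_n^{-2p}$ such that (A3) holds for $(\mathbf a_n,R_n,\lambda)$ with some $K>0$ and the given $r$, and every minimum-norm solution $\widehat\theta_\lambda$ over $\mathcal P_{\mathbf a_n,R_n}$, the following holds. * *Low noise.* There are constants $B_1>0$, $B_2>d$ depending only on $d,p,L_0$ such that, if $\mathbb P(|\eta(X)|\le t)\le Ct^q$ for all $t>0$ (with some $q,C>0$) and $\alpha<(1+\frac{B_1}{\sqrt s}+\frac{B_2}{s})^{-1}$, then $$\mathbb E[\mathcal R(\operatorname{sign}f(\cdot;\widehat\theta_\lambda))]-\mathcal R^*\le6n^{-\alpha/r}+Cn^{-\alpha q/(2r)}+4\exp\!\big(-A_1n^{1-\alpha A_2}+n^{\alpha d/s}\log(\gamma n^{\alpha\kappa})\big),$$ with $A_1=K^22^{2r(1-L_n)}/288$, $A_2=1+\frac{B_1}{\sqrt s}+\frac{B_2-d}{s}$; moreover $1-\alpha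 A_2>\alpha d/s$. * *Hard margin.* There are constants $B_1>0$, $B_2>d$ depending only on $d,p,L_0$ such that, if $\mathbb P(|\eta(X)|>\delta)=1$ for some $\delta>0$ and $\alpha<\frac{s\sqrt s}{sB_1+\sqrt sB_2}$ (a bound that tends to infinity as $s\to\infty$), then $$\mathbb E[\mathcal R(\operatorname{sign}f(\cdot;\widehat\theta_\lambda))]-\mathcal R^*\le18n^{-\alpha/r}+4\exp\!\big(-A_1n^{1-\alpha A_2}+n^{\alpha d/s}\log(\gamma n^{\alpha\kappa'}(\delta/2)^{-r})\big),$$ with $A_1=K^2(\delta2^{-L_n})^{2r}/288$, $A_2=\frac{B_1}{\sqrt s}+\frac{B_2-d}{s}$; moreover $1-\alpha A_2>\alpha d/s$. Here $\kappa,\kappa'>0$ depend only on $d,p,s,r,L_0$, and $\gamma>0$ depends only on $d,p,s,r,L_0,\alpha,R^*,\|\eta\|_{\mathcal C^s}$ and, in the hard-margin case, on $\delta$; there $\gamma$ can also be chosen independent of $\delta$ if the bound is only required for those $n$ with $n^{-\alpha/r}\le\delta^2$. In particular no constant depends on $n$, $\lambda$ or $K$, and $\rho$ enters only through the listed quantities.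 -/

import Mathlib

open MeasureTheory ProbabilityTheory Filter Asymptotics

namespace DeepClassifier

noncomputable section

/-! ### Feedforward ReLU networks -/

/-- An architecture `(a_0, ..., a_L)` of positive integers with `a_0 = d` and `a_L = 1`. -/
structure Arch (d : ℕ) where
  depth : ℕ
  depth_pos : 1 ≤ depth
  size : Fin (depth + 1) → ℕ
  size_pos : ∀ i, 1 ≤ size i
  size_zero : size 0 = d
  size_last : size (Fin.last depth) = 1

variable {d : ℕ}

/-- The width of an architecture is its largest entry. -/
def Arch.width (a : Arch d) : ℕ := Finset.univ.sup a.size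

/-- Parametrizations: one weight matrix and one bias vector per layer. The norm on this type is
the largest absolute value of an entry, and its distance is the `ℓ_∞` distance. -/
abbrev Params (a : Arch d) : Type :=
  (l : Fin a.depth) →
    (Fin (a.size l.succ) → Fin (a.size l.castSucc) → ℝ) × (Fin (a.size l.succ) → ℝ)

/-- The output of layer `i`: the ReLU follows every affine map except the last one. -/
def layerOutput (a : Arch d) (θ : Params a) (x : Fin d → ℝ) :
    (i : Fin (a.depth + 1)) → Fin (a.size i) → ℝ :=
  Fin.induction (motive := fun i => Fin (a.size i) → ℝ)
    (fun j => x (Fin.cast a.size_zero j))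
    (fun l v k =>
      if l.succ = Fin.last a.depth then (∑ j, (θ l).1 k j * v j) + (θ l).2 k
      else max 0 ((∑ j, (θ l).1 k j * v j) + (θ l).2 k))

/-- The clipping (truncation) function at level `D`. -/
def clip (D x : ℝ) : ℝ := max (-D) (min x D)

/-- The real-valued network function realized by `θ`, clipped at level `1`. -/
def net (a : Arch d) (θ : Params a) (x : Fin d → ℝ) : ℝ :=
  clip 1 (layerOutput a θ x (Fin.last a.depth) (Fin.cast a.size_last.symm 0))

/-- The parametrizations all of whose entries lie in `[-R, R]`. -/
def boundedParams (a : Arch d) (R : ℝ) : Set (Params a) := {θ | ‖θ‖ ≤ R}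

/-- The penalty `|θ|_p^p`. -/
def penalty (a : Arch d) (p : ℝ) (θ : Params a) : ℝ :=
  ∑ l, ((∑ i, ∑ j, |(θ l).1 i j| ^ p) + ∑ i, |(θ l).2 i| ^ p)

/-! ### Binary classification -/

/-- The unit cube `[0,1]^d`. -/
def cube (d : ℕ) : Set (Fin d → ℝ) := Set.Icc 0 1

/-- `ρ` is carried by `[0,1]^d × {-1, 1}`. -/
def IsBinaryLaw (ρ : Measure ((Fin d → ℝ) × ℝ)) : Prop :=
  ∀ᵐ z ∂ρ, z.1 ∈ cube d ∧ (z.2 = 1 ∨ z.2 = -1)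

/-- `Z 0, Z 1, ...` are i.i.d. observations with law `ρ`. -/
structure IsIIDSample {Ω : Type*} [MeasurableSpace Ω] (μ : Measure Ω)
    (ρ : Measure ((Fin d → ℝ) × ℝ)) (Z : ℕ → Ω → (Fin d → ℝ) × ℝ) : Prop where
  measurable : ∀ i, Measurable (Z i)
  indep : iIndepFun Z μ
  law : ∀ i, μ.map (Z i) = ρ

/-- `η` is a version of the regression function `x ↦ E[Y | X = x]`. -/
def IsRegressionFunction (ρ : Measure ((Fin d → ℝ) × ℝ)) (η : (Fin d → ℝ) → ℝ) : Prop :=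
  (fun z : (Fin d → ℝ) × ℝ => η z.1) =ᵐ[ρ]
    ρ[fun z : (Fin d → ℝ) × ℝ => z.2 | MeasurableSpace.comap Prod.fst inferInstance]

/-- The misclassification risk of `sign f`, where `sign 0 = 0`. -/
def misRisk (ρ : Measure ((Fin d → ℝ) × ℝ)) (f : (Fin d → ℝ) → ℝ) : ℝ :=
  ρ.real {z | Real.sign (f z.1) ≠ z.2}

/-- The low-noise condition with noise exponent `q` and constant `C`. -/
def LowNoise (ρ : Measure ((Fin d → ℝ) × ℝ)) (η : (Fin d → ℝ) → ℝ) (q C : ℝ) : Prop :=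
  ∀ t : ℝ, 0 < t → ρ.real {z | |η z.1| ≤ t} ≤ C * t ^ q

/-- The hard-margin condition with margin `δ`. -/
def HardMargin (ρ : Measure ((Fin d → ℝ) × ℝ)) (η : (Fin d → ℝ) → ℝ) (δ : ℝ) : Prop :=
  ∀ᵐ z ∂ρ, δ < |η z.1|

/-! ### Regularized risks and their minimizers -/

/-- The minimizers of `F` over `S`. -/
def argminOn {E : Type*} (F : E → ℝ) (S : Set E) : Set E := {θ ∈ S | ∀ θ' ∈ S, F θ ≤ F θ'}

/-- The regularized population risk for the square loss. -/
def popRisk (ρ : Measure ((Fin d → ℝ) × ℝ)) (a : Arch d) (p lam : ℝ) (θ : Params a) : ℝ :=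
  (∫ z, (net a θ z.1 - z.2) ^ 2 ∂ρ) + lam / 2 * penalty a p θ

/-- The regularized empirical risk on the first `n` observations of `z`. -/
def empRisk (z : ℕ → (Fin d → ℝ) × ℝ) (n : ℕ) (a : Arch d) (p lam : ℝ) (θ : Params a) : ℝ :=
  (1 / (n : ℝ)) * (∑ i ∈ Finset.range n, (net a θ (z i).1 - (z i).2) ^ 2)
    + lam / 2 * penalty a p θ

/-- The minimum-norm solutions of the regularized empirical risk minimization problem over the
parametrizations bounded by `R`. -/
def minNormERM (z : ℕ → (Fin d → ℝ) × ℝ) (n : ℕ) (a : Arch d) (p lam R : ℝ) :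
    Set (Params a) :=
  argminOn (fun θ => ‖θ‖) (argminOn (empRisk z n a p lam) (boundedParams a R))

/-- Well-separation at regularization level `lam`, with constants `K` and `r`, over the
parametrizations bounded by `R`: for every `t > 0`, the infimum of the regularized population risk
over the `θ` at `ℓ_∞`-distance at least `t` from the minimizers exceeds the minimum by at least
`K t^r`. -/
def WellSeparated (ρ : Measure ((Fin d → ℝ) × ℝ)) (a : Arch d) (p R lam K r : ℝ) : Prop :=
  ∀ t : ℝ, 0 < t → ∀ θmin ∈ argminOn (popRisk ρ a p lam) (boundedParams a R),
    ∀ θ ∈ boundedParams a R,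
      t ≤ Metric.infDist θ (argminOn (popRisk ρ a p lam) (boundedParams a R)) →
        K * t ^ r ≤ popRisk ρ a p lam θ - popRisk ρ a p lam θmin

/-- The unregularized population and empirical risks have minimizers among all parametrizations,
and almost surely every minimum-norm minimizer of the unregularized empirical risk, for every sample
size, is bounded by `Rstar`. (The value of `p` is irrelevant when `lam = 0`.) -/
def BoundedMinimizers {Ω : Type*} [MeasurableSpace Ω] (μ : Measure Ω)
    (ρ : Measure ((Fin d → ℝ) × ℝ)) (Z : ℕ → Ω → (Fin d → ℝ) × ℝ) (a : Arch d)
    (Rstar : ℝ) : Prop :=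
  (argminOn (popRisk ρ a 1 0) Set.univ).Nonempty ∧
  ∀ᵐ ω ∂μ, ∀ n : ℕ, 1 ≤ n →
    (argminOn (empRisk (fun i => Z i ω) n a 1 0) Set.univ).Nonempty ∧
    ∀ θ ∈ argminOn (fun θ => ‖θ‖) (argminOn (empRisk (fun i => Z i ω) n a 1 0) Set.univ),
      ‖θ‖ ≤ Rstar

/-! ### Smoothness and approximation -/

/-- The norm of `C^s([0,1]^d)`: the largest supremum over the cube of a partial derivative of order
at most `s`. -/
def csNorm (s : ℕ) (η : (Fin d → ℝ) → ℝ) : ℝ :=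
  sSup {v | ∃ k ≤ s, ∃ i : Fin k → Fin d, ∃ x ∈ cube d,
    v = |iteratedFDerivWithin ℝ k η (cube d) x (fun j => Pi.single (i j) 1)|}

/-- Some network of architecture `a`, with parameters of any size, is uniformly `ε`-close to `η` on
the cube. -/
def Approximates (a : Arch d) (η : (Fin d → ℝ) → ℝ) (ε : ℝ) : Prop :=
  ∃ θ : Params a, ∀ x ∈ cube d, |net a θ x - η x| ≤ ε

/-- `C₁ = (3s)^d d`. -/
def const1 (d s : ℕ) : ℝ := (3 * (s : ℝ)) ^ d * d

/-- `C₃ = s^d 8^s M`, where `M` is the `C^s` norm of the regression function. -/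
def const3 (d s : ℕ) (M : ℝ) : ℝ := (s : ℝ) ^ d * 8 ^ s * M

/-- The width `C₁ W₀ log₂ W₀`, rounded up. -/
def widthOf (d s W₀ : ℕ) : ℕ := ⌈const1 d s * (W₀ * Real.logb 2 W₀)⌉₊

/-- The depth `C₂ L₀ log₂ L₀ + 2d` with `C₂ = √s`, rounded up. -/
def depthOf (d s L₀ : ℕ) : ℕ := ⌈√(s : ℝ) * (L₀ * Real.logb 2 L₀)⌉₊ + 2 * d

/-- `η` is of class `C^s` on the cube and is approximated by ReLU networks at the rate
`C₃ (W₀ L₀)^(-2s/d)` with width `C₁ W₀ log₂ W₀` and depth `C₂ L₀ log₂ L₀ + 2d`. -/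
def RegularRegression (s : ℕ) (η : (Fin d → ℝ) → ℝ) : Prop :=
  ContDiffOn ℝ s η (cube d) ∧
  ∀ W₀ L₀ : ℕ, 2 ≤ W₀ → 2 ≤ L₀ →
    ∃ a : Arch d, a.width = widthOf d s W₀ ∧ a.depth = depthOf d s L₀ ∧
      Approximates a η (const3 d s (csNorm s η) *
        (W₀ : ℝ) ^ (-(2 * (s : ℝ) / d)) * (L₀ : ℝ) ^ (-(2 * (s : ℝ) / d)))

/-! ### The network family -/

/-- `W₀ = L₀⁻¹ (n^(-α/r) / C₃)^(-d/(2s))`, rounded up to an integer that is at least `2`. -/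
def baseWidth (d s L₀ : ℕ) (r α M : ℝ) (n : ℕ) : ℕ :=
  max 2 ⌈(L₀ : ℝ)⁻¹ * ((n : ℝ) ^ (-(α / r)) / const3 d s M) ^ (-((d : ℝ) / (2 * s)))⌉₊

/-- The width `W_n`. -/
def widthSeq (d s L₀ : ℕ) (r α M : ℝ) (n : ℕ) : ℕ := widthOf d s (baseWidth d s L₀ r α M n)

/-- The parameter bound `R_n = R* (L_n (W_n² + W_n))^(1/p)`. -/
def boundSeq (d s L₀ : ℕ) (p r α M Rstar : ℝ) (n : ℕ) : ℝ :=
  Rstar * ((depthOf d s L₀ : ℝ) *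
    ((widthSeq d s L₀ r α M n : ℝ) ^ 2 + widthSeq d s L₀ r α M n)) ^ (1 / p)

/-- The largest admissible regularization parameter `c n^(-2α/r) R_n^(-2p)`. -/
def lamMax (d s L₀ : ℕ) (p r α M Rstar c : ℝ) (n : ℕ) : ℝ :=
  c * (n : ℝ) ^ (-(2 * α / r)) * boundSeq d s L₀ p r α M Rstar n ^ (-(2 * p))

/-- `u n` is bounded by a constant times `n^e`, up to a power of `log n`. -/
def IsSoftO (u : ℕ → ℝ) (e : ℝ) : Prop :=
  ∃ k : ℕ, u =O[atTop] fun n : ℕ => (n : ℝ) ^ e * Real.log n ^ k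

end

end DeepClassifier

namespace DeepClassifier

variable {d : ℕ}

/-! ### Networks as functions of their parameters -/

/-! Fix the sample size and a margin `m`, and write `ε = n^(-α/r)`. On the cube a network is
Lipschitz in its parameters, with a constant `Λ` of order `L (W R)^L` (`net_sub_abs_le`).
Hoeffding's inequality on a finite grid of parameters therefore makes the empirical risk uniformly
close to the population risk (`exists_uniform_deviation_event`). By well-separation, a deviation
below `K t^r / 2` puts every empirical minimizer within `t` of a population minimizer `θ₀`. With `t
= m / (2Λ)` the two networks differ by at most `m / 2` on the cube.

The network of `θ₀` is in turn `L²`-close to `η`. The square risk is the squared `L²` distance to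
`η` plus a noise term (`sqRisk_eq_add`), so it suffices to find a competitor inside the parameter
ball with small penalty. The approximating network may have huge parameters, but consistency of the
bounded empirical minimizers gives a parametrization of norm at most `Rstar` that is no worse
(`exists_norm_le_forall_sqRisk_le`). Hence the squared distance is at most `3ε²/2`. By Chebyshev the
signs agree outside `{|η| ≤ m}` and a set of probability `6ε²/m²` (`misRisk_net_sub_le`). Low noise
takes `m² = ε`, hard margin takes `m = δ`.

What remains is the bad event: a covering number times a Gaussian tail. The depth is fixed in `n`,
so `Λ` is polynomial in `n`, which determines `A₂`. The number of parameters grows, up to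
logarithms, like `n^(αd/(rs))`; as `r > 1`, the gap to `n^(αd/s)` absorbs the logarithm of the
covering scale (`powLE_entropy`).

Uniformity in `K` needs two further remarks, both using that the bound is trivial once its last
exponent is nonnegative. If `K` is very small the bound is trivial; otherwise `1/K` is polynomially
bounded and the covering number is under control (`covering_mul_tail_le`). For the finitely many `n`
below a threshold, `K` is bounded above by a quantity independent of `ρ`
(`exists_forall_wellSeparated_const_le`), so enlarging `γ` makes the bound trivial there. -/

lemma layerOutput_zero (a : Arch d) (θ : Params a) (x : Fin d → ℝ) (j : Fin (a.size 0)) :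
    layerOutput a θ x 0 j = x (Fin.cast a.size_zero j) := rfl

lemma layerOutput_succ (a : Arch d) (θ : Params a) (x : Fin d → ℝ) (l : Fin a.depth)
    (k : Fin (a.size l.succ)) :
    layerOutput a θ x l.succ k =
      if l.succ = Fin.last a.depth then
        (∑ j, (θ l).1 k j * layerOutput a θ x l.castSucc j) + (θ l).2 k
      else max 0 ((∑ j, (θ l).1 k j * layerOutput a θ x l.castSucc j) + (θ l).2 k) := rfl

lemma Arch.size_le_width (a : Arch d) (i : Fin (a.depth + 1)) : a.size i ≤ a.width :=
  Finset.le_sup (f := a.size) (Finset.mem_univ i)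

lemma abs_weight_le (a : Arch d) (θ : Params a) (l : Fin a.depth) (k : Fin (a.size l.succ))
    (j : Fin (a.size l.castSucc)) : |(θ l).1 k j| ≤ ‖θ‖ :=
  calc |(θ l).1 k j| ≤ ‖(θ l).1 k‖ := norm_le_pi_norm ((θ l).1 k) j
    _ ≤ ‖(θ l).1‖ := norm_le_pi_norm (θ l).1 k
    _ ≤ ‖θ l‖ := norm_fst_le (θ l)
    _ ≤ ‖θ‖ := norm_le_pi_norm θ l

lemma abs_bias_le (a : Arch d) (θ : Params a) (l : Fin a.depth) (k : Fin (a.size l.succ)) :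
    |(θ l).2 k| ≤ ‖θ‖ :=
  calc |(θ l).2 k| ≤ ‖(θ l).2‖ := norm_le_pi_norm (θ l).2 k
    _ ≤ ‖θ l‖ := norm_snd_le (θ l)
    _ ≤ ‖θ‖ := norm_le_pi_norm θ l

lemma params_norm_le (a : Arch d) (θ : Params a) {R : ℝ} (hR : 0 ≤ R)
    (h1 : ∀ l k j, |(θ l).1 k j| ≤ R) (h2 : ∀ l k, |(θ l).2 k| ≤ R) : ‖θ‖ ≤ R := by
  refine (pi_norm_le_iff_of_nonneg hR).2 fun l => ?_
  refine norm_prod_le_iff.2 ⟨?_, ?_⟩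
  · refine (pi_norm_le_iff_of_nonneg hR).2 fun k => ?_
    exact (pi_norm_le_iff_of_nonneg hR).2 fun j => h1 l k j
  · exact (pi_norm_le_iff_of_nonneg hR).2 fun k => h2 l k

lemma abs_sum_mul_le {n : ℕ} (w v : Fin n → ℝ) {A B : ℝ} (hA : ∀ j, |w j| ≤ A)
    (hB : ∀ j, |v j| ≤ B) : |∑ j, w j * v j| ≤ n * (A * B) := by
  calc |∑ j, w j * v j| ≤ ∑ j, |w j * v j| := Finset.abs_sum_le_sum_abs _ _
    _ ≤ ∑ _j : Fin n, A * B := by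
        refine Finset.sum_le_sum fun j _ => ?_
        rw [abs_mul]
        exact mul_le_mul (hA j) (hB j) (abs_nonneg _) ((abs_nonneg _).trans (hA j))
    _ = n * (A * B) := by simp

/-- Each layer multiplies the size by at most `width * max R 1` and adds a bias of at most `max R
1`. Replacing `R` by `max R 1` keeps all powers at least one, so the bias is absorbed by the `+ 1`
in the base. -/
lemma layerOutput_abs_le (a : Arch d) (θ : Params a) {R : ℝ} (hθ : ‖θ‖ ≤ R)
    {x : Fin d → ℝ} (hx : x ∈ cube d) (i : Fin (a.depth + 1)) :
    ∀ j, |layerOutput a θ x i j| ≤ ((a.width + 1) * max R 1) ^ (i : ℕ) := by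
  set Q : ℝ := (a.width + 1) * max R 1 with hQ
  have hW : (0 : ℝ) ≤ a.width := Nat.cast_nonneg _
  have hR1 : 1 ≤ max R 1 := le_max_right _ _
  have hQ1 : 1 ≤ Q := by nlinarith
  induction i using Fin.induction with
  | zero =>
    intro j
    rw [layerOutput_zero]
    have h := (Set.mem_Icc.1 hx)
    have h0 := h.1 (Fin.cast a.size_zero j)
    have h1 := h.2 (Fin.cast a.size_zero j)
    simp only [Pi.zero_apply, Pi.one_apply] at h0 h1
    simpa [abs_of_nonneg h0] using h1
  | succ l ih =>
    intro k
    have hQl : 1 ≤ Q ^ (l : ℕ) := one_le_pow₀ hQ1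
    have key : |(∑ j, (θ l).1 k j * layerOutput a θ x l.castSucc j) + (θ l).2 k|
        ≤ Q ^ ((l : ℕ) + 1) := by
      have h1 := abs_sum_mul_le (fun j => (θ l).1 k j) (fun j => layerOutput a θ x l.castSucc j)
        (fun j => (abs_weight_le a θ l k j).trans (hθ.trans (le_max_left R 1))) ih
      have h2 := (abs_bias_le a θ l k).trans (hθ.trans (le_max_left R 1))
      have hs : (a.size l.castSucc : ℝ) ≤ a.width := by exact_mod_cast a.size_le_width _
      simp only [Fin.val_castSucc] at h1
      calc |(∑ j, (θ l).1 k j * layerOutput a θ x l.castSucc j) + (θ l).2 k|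
          ≤ (a.size l.castSucc) * (max R 1 * Q ^ (l : ℕ)) + max R 1 :=
            (abs_add_le _ _).trans (add_le_add h1 h2)
        _ ≤ a.width * (max R 1 * Q ^ (l : ℕ)) + max R 1 * Q ^ (l : ℕ) := by
            refine add_le_add (mul_le_mul_of_nonneg_right hs (by positivity)) ?_
            exact le_mul_of_one_le_right (by positivity) hQl
        _ = Q ^ ((l : ℕ) + 1) := by rw [pow_succ, hQ]; ring
    rw [layerOutput_succ, Fin.val_succ]
    split_ifs
    · exact key
    · refine le_trans ?_ key
      rw [abs_of_nonneg (le_max_left _ _)]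
      exact max_le (abs_nonneg _) (le_abs_self _)

lemma abs_max_zero_sub_le (u v : ℝ) : |max 0 u - max 0 v| ≤ |u - v| := by
  simpa [max_comm] using abs_max_sub_max_le_abs u v 0

/-- Telescoping `wv - w'v' = w(v - v') + (w - w')v'`: the first term propagates the earlier error,
the second creates a new one of size `Q^l D` per unit. Every layer contributes one such error,
whence the factor `i`. -/
lemma layerOutput_sub_abs_le (a : Arch d) (θ θ' : Params a) {R : ℝ} (hθ : ‖θ‖ ≤ R)
    (hθ' : ‖θ'‖ ≤ R) {x : Fin d → ℝ} (hx : x ∈ cube d) (i : Fin (a.depth + 1)) :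
    ∀ j, |layerOutput a θ x i j - layerOutput a θ' x i j| ≤
      i * ((a.width + 1) * max R 1) ^ (i : ℕ) * ‖θ - θ'‖ := by
  set Q : ℝ := (a.width + 1) * max R 1 with hQ
  have hW : (0 : ℝ) ≤ a.width := Nat.cast_nonneg _
  have hR1 : 1 ≤ max R 1 := le_max_right _ _
  have hQ1 : 1 ≤ Q := by nlinarith
  set D := ‖θ - θ'‖
  have hD : 0 ≤ D := norm_nonneg _
  induction i using Fin.induction with
  | zero => intro j; simp [layerOutput_zero]
  | succ l ih =>
    intro k
    have hQl : 1 ≤ Q ^ (l : ℕ) := one_le_pow₀ hQ1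
    have hs : (a.size l.castSucc : ℝ) ≤ a.width := by exact_mod_cast a.size_le_width _
    have key : |((∑ j, (θ l).1 k j * layerOutput a θ x l.castSucc j) + (θ l).2 k)
        - ((∑ j, (θ' l).1 k j * layerOutput a θ' x l.castSucc j) + (θ' l).2 k)|
        ≤ ((l : ℕ) + 1 : ℕ) * Q ^ ((l : ℕ) + 1) * D := by
      have h1 := abs_sum_mul_le (fun j => (θ l).1 k j)
        (fun j => layerOutput a θ x l.castSucc j - layerOutput a θ' x l.castSucc j)
        (fun j => (abs_weight_le a θ l k j).trans (hθ.trans (le_max_left R 1))) ih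
      have h2 := abs_sum_mul_le (fun j => ((θ - θ') l).1 k j)
        (fun j => layerOutput a θ' x l.castSucc j)
        (fun j => abs_weight_le a (θ - θ') l k j) (layerOutput_abs_le a θ' hθ' hx _)
      have h3 := abs_bias_le a (θ - θ') l k
      simp only [Fin.val_castSucc] at h1 h2
      rw [← hQ] at h2
      have e : ((∑ j, (θ l).1 k j * layerOutput a θ x l.castSucc j) + (θ l).2 k)
        - ((∑ j, (θ' l).1 k j * layerOutput a θ' x l.castSucc j) + (θ' l).2 k)
        = (∑ j, (θ l).1 k j * (layerOutput a θ x l.castSucc j - layerOutput a θ' x l.castSucc j))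
          + (∑ j, ((θ - θ') l).1 k j * layerOutput a θ' x l.castSucc j)
          + ((θ - θ') l).2 k := by
        simp only [Pi.sub_apply, Prod.fst_sub, Prod.snd_sub, mul_sub, sub_mul,
          Finset.sum_sub_distrib]
        ring
      rw [e]
      calc _ ≤ (a.size l.castSucc) * (max R 1 * ((l : ℕ) * Q ^ (l : ℕ) * D))
            + (a.size l.castSucc) * (D * Q ^ (l : ℕ)) + D :=
            (abs_add_le _ _).trans (add_le_add ((abs_add_le _ _).trans (add_le_add h1 h2)) h3)
        _ ≤ a.width * (max R 1 * ((l : ℕ) * Q ^ (l : ℕ) * D))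
            + a.width * (D * Q ^ (l : ℕ)) + D * Q ^ (l : ℕ) := by
            refine add_le_add (add_le_add (mul_le_mul_of_nonneg_right hs (by positivity))
              (mul_le_mul_of_nonneg_right hs (by positivity))) ?_
            exact le_mul_of_one_le_right hD hQl
        _ ≤ (a.width + 1) * (max R 1 * ((l : ℕ) * Q ^ (l : ℕ) * D))
            + (a.width + 1) * (max R 1 * (D * Q ^ (l : ℕ))) := by
            have : D * Q ^ (l : ℕ) ≤ max R 1 * (D * Q ^ (l : ℕ)) :=
              le_mul_of_one_le_left (by positivity) hR1
            have h5 : 0 ≤ max R 1 * ((l : ℕ) * Q ^ (l : ℕ) * D) := by positivity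
            nlinarith
        _ = ((l : ℕ) + 1 : ℕ) * Q ^ ((l : ℕ) + 1) * D := by
            rw [pow_succ, hQ]; push_cast; ring
    rw [layerOutput_succ, layerOutput_succ, Fin.val_succ]
    split_ifs
    · exact key
    · exact (abs_max_zero_sub_le _ _).trans key

lemma clip_one_abs_le (u : ℝ) : |clip 1 u| ≤ 1 :=
  abs_le.2 ⟨le_max_left _ _, max_le (by norm_num) (min_le_right _ _)⟩

lemma clip_one_of_abs_le {u : ℝ} (hu : |u| ≤ 1) : clip 1 u = u := by
  rw [abs_le] at hu
  rw [clip, min_eq_left hu.2, max_eq_right hu.1]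

lemma clip_sub_abs_le (D u v : ℝ) : |clip D u - clip D v| ≤ |u - v| := by
  unfold clip
  refine (abs_max_sub_max_le_max _ _ _ _).trans ?_
  simp only [sub_self, abs_zero]
  refine max_le (abs_nonneg _) ((abs_min_sub_min_le_max _ _ _ _).trans ?_)
  simp

lemma net_abs_le (a : Arch d) (θ : Params a) (x : Fin d → ℝ) : |net a θ x| ≤ 1 :=
  clip_one_abs_le _

/-- A Lipschitz constant of `θ ↦ net a θ x` over parametrizations bounded by `R`, for an
architecture of depth `L` and width `W`. -/
noncomputable def lipConst (L W : ℕ) (R : ℝ) : ℝ := L * ((W + 1) * max R 1) ^ L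

lemma one_le_lipConst {L W : ℕ} (hL : 1 ≤ L) (R : ℝ) : 1 ≤ lipConst L W R := by
  have hW : (0 : ℝ) ≤ W := Nat.cast_nonneg _
  have hR1 : 1 ≤ max R 1 := le_max_right _ _
  have hQ1 : 1 ≤ ((W : ℝ) + 1) * max R 1 := by nlinarith
  have hL' : (1 : ℝ) ≤ L := by exact_mod_cast hL
  exact one_le_mul_of_one_le_of_one_le hL' (one_le_pow₀ hQ1)

lemma net_sub_abs_le (a : Arch d) {θ θ' : Params a} {R : ℝ} (hθ : ‖θ‖ ≤ R)
    (hθ' : ‖θ'‖ ≤ R) {x : Fin d → ℝ} (hx : x ∈ cube d) :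
    |net a θ x - net a θ' x| ≤ lipConst a.depth a.width R * ‖θ - θ'‖ := by
  refine (clip_sub_abs_le _ _ _).trans ?_
  simpa [lipConst] using layerOutput_sub_abs_le a θ θ' hθ hθ' hx (Fin.last a.depth)
    (Fin.cast a.size_last.symm 0)

lemma continuous_layerOutput (a : Arch d) (i : Fin (a.depth + 1)) :
    ∀ j, Continuous fun q : Params a × (Fin d → ℝ) => layerOutput a q.1 q.2 i j := by
  induction i using Fin.induction with
  | zero => intro j; simp only [layerOutput_zero]; fun_prop
  | succ l ih =>
    intro k
    have h : Continuous fun q : Params a × (Fin d → ℝ) =>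
        (∑ j, (q.1 l).1 k j * layerOutput a q.1 q.2 l.castSucc j) + (q.1 l).2 k := by
      refine Continuous.add (continuous_finsetSum _ fun j _ => Continuous.mul ?_ (ih j)) ?_
      · fun_prop
      · fun_prop
    simp only [layerOutput_succ]
    split_ifs
    · exact h
    · exact continuous_const.max h

lemma continuous_net (a : Arch d) :
    Continuous fun q : Params a × (Fin d → ℝ) => net a q.1 q.2 :=
  continuous_const.max ((continuous_layerOutput a _ _).min continuous_const)

lemma continuous_net_left (a : Arch d) (x : Fin d → ℝ) : Continuous fun θ => net a θ x :=
  (continuous_net a).comp (Continuous.prodMk continuous_id continuous_const)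

lemma continuous_net_right (a : Arch d) (θ : Params a) : Continuous (net a θ) :=
  (continuous_net a).comp (Continuous.prodMk continuous_const continuous_id)

/-! ### Constant networks -/

/-- The parametrization with zero weights and with last bias `b`. -/
def constParams (a : Arch d) (b : ℝ) : Params a :=
  fun l => (0, fun _ => if l.succ = Fin.last a.depth then b else 0)

lemma norm_constParams_le (a : Arch d) (b : ℝ) : ‖constParams a b‖ ≤ |b| := by
  refine params_norm_le a _ (abs_nonneg b) (fun l k j => by simp [constParams]) fun l k => ?_
  simp only [constParams]
  split_ifs <;> simp

lemma net_constParams (a : Arch d) {b : ℝ} (hb : |b| ≤ 1) (x : Fin d → ℝ) :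
    net a (constParams a b) x = b := by
  have key : ∀ i : Fin (a.depth + 1), i = Fin.last a.depth → i ≠ 0 →
      ∀ j, layerOutput a (constParams a b) x i j = b := by
    intro i hi h0
    induction i using Fin.cases with
    | zero => exact absurd rfl h0
    | succ l =>
      intro j
      rw [layerOutput_succ, if_pos hi]
      simp [constParams, hi]
  have h0 : Fin.last a.depth ≠ 0 := by
    have := a.depth_pos
    intro h
    have := congrArg Fin.val h
    simp at this
    omega
  rw [net, key _ rfl h0, clip_one_of_abs_le hb]

/-! ### The penalty -/

lemma penalty_nonneg (a : Arch d) (p : ℝ) (θ : Params a) : 0 ≤ penalty a p θ := by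
  unfold penalty
  positivity

/-- A bound for the number of parameters. -/
lemma sum_params_le (a : Arch d) :
    ∑ l : Fin a.depth, (a.size l.succ * a.size l.castSucc + a.size l.succ) ≤
      a.depth * (a.width ^ 2 + a.width) := by
  calc _ ≤ ∑ _l : Fin a.depth, (a.width ^ 2 + a.width) := by
        refine Finset.sum_le_sum fun l _ => ?_
        rw [pow_two]
        exact add_le_add (Nat.mul_le_mul (a.size_le_width _) (a.size_le_width _))
          (a.size_le_width _)
    _ = _ := by simp

lemma penalty_le (a : Arch d) {p : ℝ} (hp : 0 < p) {θ : Params a} {R : ℝ} (hθ : ‖θ‖ ≤ R) :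
    penalty a p θ ≤ a.depth * ((a.width : ℝ) ^ 2 + a.width) * R ^ p := by
  have hR : 0 ≤ R := (norm_nonneg _).trans hθ
  have hRp : 0 ≤ R ^ p := Real.rpow_nonneg hR p
  calc penalty a p θ
      ≤ ∑ l : Fin a.depth, ((∑ _i : Fin (a.size l.succ), ∑ _j : Fin (a.size l.castSucc), R ^ p)
          + ∑ _i : Fin (a.size l.succ), R ^ p) := by
        unfold penalty
        gcongr with l _ i _ j _ i _
        · exact (abs_weight_le a θ l i j).trans hθ
        · exact (abs_bias_le a θ l i).trans hθ
    _ = ((∑ l : Fin a.depth, (a.size l.succ * a.size l.castSucc + a.size l.succ) : ℕ) : ℝ)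
          * R ^ p := by
        push_cast
        rw [Finset.sum_mul]
        refine Finset.sum_congr rfl fun l _ => ?_
        simp
        ring
    _ ≤ _ := by
        refine mul_le_mul_of_nonneg_right ?_ hRp
        exact_mod_cast sum_params_le a

lemma continuous_penalty (a : Arch d) {p : ℝ} (hp : 0 < p) : Continuous (penalty a p) := by
  unfold penalty
  refine continuous_finsetSum _ fun l _ => Continuous.add ?_ ?_
  · refine continuous_finsetSum _ fun i _ => continuous_finsetSum _ fun j _ => ?_
    refine Continuous.rpow_const (by fun_prop) fun _ => Or.inr hp.le
  · refine continuous_finsetSum _ fun i _ => ?_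
    refine Continuous.rpow_const (by fun_prop) fun _ => Or.inr hp.le

/-! ### A finite net of the parameter ball -/

lemma exists_finset_interval_net {R h : ℝ} (hR : 0 ≤ R) (hh : 0 < h) :
    ∃ G : Finset ℝ, (G.card : ℝ) ≤ 2 * R / h + 1 ∧ (∀ g ∈ G, |g| ≤ R) ∧
      ∀ x, |x| ≤ R → ∃ g ∈ G, |x - g| ≤ h := by
  refine ⟨(Finset.range (⌊2 * R / h⌋₊ + 1)).image fun i : ℕ => -R + i * h, ?_, ?_, ?_⟩
  · refine (Nat.cast_le.2 Finset.card_image_le).trans ?_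
    rw [Finset.card_range]
    push_cast
    have := Nat.floor_le (show 0 ≤ 2 * R / h by positivity)
    linarith
  · intro g hg
    obtain ⟨i, hi, rfl⟩ := Finset.mem_image.1 hg
    have hi' : (i : ℝ) ≤ 2 * R / h :=
      (Nat.cast_le.2 (Nat.lt_succ_iff.1 (Finset.mem_range.1 hi))).trans
        (Nat.floor_le (show 0 ≤ 2 * R / h by positivity))
    rw [le_div_iff₀ hh] at hi'
    have : 0 ≤ (i : ℝ) * h := by positivity
    rw [abs_le]
    constructor <;> linarith
  · intro x hx
    rw [abs_le] at hx
    have h0 : 0 ≤ (x + R) / h := div_nonneg (by linarith) hh.le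
    refine ⟨-R + ⌊(x + R) / h⌋₊ * h, Finset.mem_image.2 ⟨_, Finset.mem_range.2 ?_, rfl⟩, ?_⟩
    · refine Nat.lt_succ_of_le (Nat.floor_le_floor ?_)
      gcongr
      linarith
    · have h1 := Nat.floor_le h0
      have h2 := (Nat.lt_floor_add_one ((x + R) / h)).le
      rw [le_div_iff₀ hh] at h1
      rw [div_le_iff₀ hh] at h2
      rw [abs_le]
      constructor <;> linarith

/-- A product of one-dimensional grids, one for each scalar parameter; the exponent is the bound for
their number. -/
lemma exists_finset_params_net (a : Arch d) {R h : ℝ} (hR : 0 ≤ R) (hh : 0 < h) :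
    ∃ C : Finset (Params a),
      (C.card : ℝ) ≤ (2 * R / h + 1) ^ (a.depth * (a.width ^ 2 + a.width)) ∧
      (∀ c ∈ C, ‖c‖ ≤ R) ∧ ∀ θ : Params a, ‖θ‖ ≤ R → ∃ c ∈ C, ‖θ - c‖ ≤ h := by
  classical
  obtain ⟨G, hcard, hGR, hG⟩ := exists_finset_interval_net hR hh
  choose! q hqG hq using hG
  refine ⟨Fintype.piFinset fun l =>
    (Fintype.piFinset fun _ => Fintype.piFinset fun _ => G) ×ˢ (Fintype.piFinset fun _ => G),
    ?_, ?_, ?_⟩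
  · have h1 : (1 : ℝ) ≤ 2 * R / h + 1 := by
      have : 0 ≤ 2 * R / h := by positivity
      linarith
    refine le_trans ?_ (pow_le_pow_right₀ h1 (sum_params_le a))
    rw [Fintype.card_piFinset, Nat.cast_prod, ← Finset.prod_pow_eq_pow_sum]
    refine Finset.prod_le_prod (fun _ _ => Nat.cast_nonneg _) fun l _ => ?_
    rw [Finset.card_product]
    simp only [Fintype.card_piFinset, Finset.prod_const, Finset.card_univ, Fintype.card_fin]
    push_cast
    rw [← pow_mul, ← pow_add, mul_comm (a.size l.castSucc)]
    gcongr
  · intro c hc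
    simp only [Fintype.mem_piFinset, Finset.mem_product] at hc
    exact params_norm_le a c hR (fun l k j => hGR _ ((hc l).1 k j)) fun l k => hGR _ ((hc l).2 k)
  · intro θ hθ
    refine ⟨fun l => (fun k j => q ((θ l).1 k j), fun k => q ((θ l).2 k)), ?_, ?_⟩
    · simp only [Fintype.mem_piFinset, Finset.mem_product]
      exact fun l => ⟨fun k j => hqG _ ((abs_weight_le a θ l k j).trans hθ),
        fun k => hqG _ ((abs_bias_le a θ l k).trans hθ)⟩
    · exact params_norm_le a _ hh.le (fun l k j => hq _ ((abs_weight_le a θ l k j).trans hθ))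
        fun l k => hq _ ((abs_bias_le a θ l k).trans hθ)

/-! ### The square loss -/

lemma sqLoss_nonneg_le {u v : ℝ} (hu : |u| ≤ 1) (hv : v = 1 ∨ v = -1) :
    (u - v) ^ 2 ∈ Set.Icc (0 : ℝ) 4 := by
  rw [abs_le] at hu
  refine ⟨sq_nonneg _, ?_⟩
  rcases hv with rfl | rfl <;> nlinarith

lemma sqLoss_sub_abs_le {u u' v : ℝ} (hu : |u| ≤ 1) (hu' : |u'| ≤ 1) (hv : v = 1 ∨ v = -1) :
    |(u - v) ^ 2 - (u' - v) ^ 2| ≤ 4 * |u - u'| := by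
  have e : (u - v) ^ 2 - (u' - v) ^ 2 = (u + u' - 2 * v) * (u - u') := by ring
  rw [e, abs_mul]
  refine mul_le_mul_of_nonneg_right ?_ (abs_nonneg _)
  rw [abs_le] at hu hu' ⊢
  rcases hv with rfl | rfl <;> constructor <;> linarith

/-! ### The population risk. -/

section Population

variable {ρ : Measure ((Fin d → ℝ) × ℝ)}

lemma measurable_sqLoss (a : Arch d) (θ : Params a) :
    Measurable fun z : (Fin d → ℝ) × ℝ => (net a θ z.1 - z.2) ^ 2 :=
  ((((continuous_net_right a θ).comp continuous_fst).sub continuous_snd).pow 2).measurable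

lemma ae_sqLoss_mem (hρ : IsBinaryLaw ρ) (a : Arch d) (θ : Params a) :
    ∀ᵐ z ∂ρ, (net a θ z.1 - z.2) ^ 2 ∈ Set.Icc (0 : ℝ) 4 :=
  hρ.mono fun z hz => sqLoss_nonneg_le (net_abs_le a θ z.1) hz.2

lemma integrable_sqLoss [IsProbabilityMeasure ρ] (hρ : IsBinaryLaw ρ) (a : Arch d) (θ : Params a) :
    Integrable (fun z : (Fin d → ℝ) × ℝ => (net a θ z.1 - z.2) ^ 2) ρ :=
  Integrable.of_mem_Icc 0 4 (measurable_sqLoss a θ).aemeasurable (ae_sqLoss_mem hρ a θ)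

/-- The unregularized population risk. -/
noncomputable def sqRisk (ρ : Measure ((Fin d → ℝ) × ℝ)) (a : Arch d) (θ : Params a) : ℝ :=
  ∫ z, (net a θ z.1 - z.2) ^ 2 ∂ρ

lemma sqRisk_nonneg (ρ : Measure ((Fin d → ℝ) × ℝ)) (a : Arch d) (θ : Params a) :
    0 ≤ sqRisk ρ a θ :=
  integral_nonneg fun _ => sq_nonneg _

lemma sqRisk_le [IsProbabilityMeasure ρ] (hρ : IsBinaryLaw ρ) (a : Arch d) (θ : Params a) : sqRisk ρ a θ ≤ 4 := by
  have h := integral_mono_ae (integrable_sqLoss hρ a θ) (integrable_const 4)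
    ((ae_sqLoss_mem hρ a θ).mono fun z hz => hz.2)
  simpa [sqRisk] using h

lemma popRisk_eq (p lam : ℝ) (a : Arch d) (θ : Params a) :
    popRisk ρ a p lam θ = sqRisk ρ a θ + lam / 2 * penalty a p θ := rfl

lemma sqRisk_sub_abs_le [IsProbabilityMeasure ρ] (hρ : IsBinaryLaw ρ) (a : Arch d) {θ θ' : Params a} {R : ℝ}
    (hθ : ‖θ‖ ≤ R) (hθ' : ‖θ'‖ ≤ R) :
    |sqRisk ρ a θ - sqRisk ρ a θ'| ≤ 4 * (lipConst a.depth a.width R * ‖θ - θ'‖) := by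
  rw [sqRisk, sqRisk, ← integral_sub (integrable_sqLoss hρ a θ) (integrable_sqLoss hρ a θ'),
    ← Real.norm_eq_abs]
  refine (norm_integral_le_of_norm_le_const (C := 4 * (lipConst a.depth a.width R * ‖θ - θ'‖))
    ?_).trans (by simp)
  filter_upwards [hρ] with z hz
  refine (sqLoss_sub_abs_le (net_abs_le a θ _) (net_abs_le a θ' _) hz.2).trans ?_
  exact mul_le_mul_of_nonneg_left (net_sub_abs_le a hθ hθ' hz.1) (by norm_num)

lemma continuous_sqRisk [IsProbabilityMeasure ρ] (hρ : IsBinaryLaw ρ) (a : Arch d) : Continuous (sqRisk ρ a) := by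
  refine continuous_of_dominated (bound := fun _ => 4)
    (fun θ => (measurable_sqLoss a θ).aestronglyMeasurable) (fun θ => ?_) (integrable_const _) ?_
  · filter_upwards [ae_sqLoss_mem hρ a θ] with z hz
    rw [Real.norm_of_nonneg hz.1]
    exact hz.2
  · exact ae_of_all _ fun z => ((continuous_net_left a z.1).sub continuous_const).pow 2

lemma continuous_popRisk [IsProbabilityMeasure ρ] (hρ : IsBinaryLaw ρ) (a : Arch d) {p : ℝ} (hp : 0 < p) (lam : ℝ) :
    Continuous (popRisk ρ a p lam) :=
  (continuous_sqRisk hρ a).add (continuous_const.mul (continuous_penalty a hp))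

lemma argminOn_nonempty {E : Type*} [TopologicalSpace E] {F : E → ℝ} (hF : Continuous F)
    {S : Set E} (hS : IsCompact S) (hne : S.Nonempty) : (argminOn F S).Nonempty := by
  obtain ⟨x, hx, h⟩ := hS.exists_isMinOn hne hF.continuousOn
  exact ⟨x, hx, fun y hy => h hy⟩

lemma isCompact_boundedParams (a : Arch d) (R : ℝ) : IsCompact (boundedParams a R) := by
  have : boundedParams a R = Metric.closedBall 0 R := by
    ext θ
    simp [boundedParams]
  rw [this]
  exact isCompact_closedBall 0 R

lemma boundedParams_nonempty (a : Arch d) {R : ℝ} (hR : 0 ≤ R) : (boundedParams a R).Nonempty :=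
  ⟨0, by simpa [boundedParams] using hR⟩

/-! ### The regression function -/

lemma ae_abs_regression_le {η : (Fin d → ℝ) → ℝ} (hρ : IsBinaryLaw ρ)
    (hη : IsRegressionFunction ρ η) : ∀ᵐ z ∂ρ, |η z.1| ≤ 1 := by
  have h := ae_bdd_abs_condExp_of_ae_bdd_abs (μ := ρ)
    (m := MeasurableSpace.comap (Prod.fst : (Fin d → ℝ) × ℝ → (Fin d → ℝ)) inferInstance)
    (R := 1) (f := fun z : (Fin d → ℝ) × ℝ => z.2) (by
      filter_upwards [hρ] with z hz
      rcases hz.2 with h | h <;> simp [h])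
  filter_upwards [h, hη] with z h1 h2
  simpa [h2] using h1

lemma aestronglyMeasurable_regression {η : (Fin d → ℝ) → ℝ} (hη : IsRegressionFunction ρ η) :
    AEStronglyMeasurable[MeasurableSpace.comap (Prod.fst : (Fin d → ℝ) × ℝ → (Fin d → ℝ))
      inferInstance] (fun z : (Fin d → ℝ) × ℝ => η z.1) ρ :=
  ⟨_, stronglyMeasurable_condExp, hη⟩

lemma comap_fst_le : MeasurableSpace.comap (Prod.fst : (Fin d → ℝ) × ℝ → (Fin d → ℝ))
    inferInstance ≤ (inferInstance : MeasurableSpace ((Fin d → ℝ) × ℝ)) :=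
  measurable_fst.comap_le

/-- Pythagoras: `net - η` is a bounded function of `X`, hence orthogonal to `Y - E[Y | X]`. -/
lemma sqRisk_eq_add [IsProbabilityMeasure ρ] {η : (Fin d → ℝ) → ℝ}
    (hρ : IsBinaryLaw ρ) (hη : IsRegressionFunction ρ η) (a : Arch d) (θ : Params a) :
    sqRisk ρ a θ = (∫ z, (net a θ z.1 - η z.1) ^ 2 ∂ρ) + ∫ z, (η z.1 - z.2) ^ 2 ∂ρ := by
  have hηm := aestronglyMeasurable_regression hη
  have hηm' : AEStronglyMeasurable (fun z : (Fin d → ℝ) × ℝ => η z.1) ρ := hηm.mono comap_fst_le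
  have hη1 := ae_abs_regression_le hρ hη
  have hnetm : AEStronglyMeasurable[MeasurableSpace.comap
      (Prod.fst : (Fin d → ℝ) × ℝ → (Fin d → ℝ)) inferInstance]
      (fun z : (Fin d → ℝ) × ℝ => net a θ z.1) ρ :=
    (StronglyMeasurable.comp_measurable (continuous_net_right a θ).stronglyMeasurable
      (comap_measurable _)).aestronglyMeasurable
  have hdm := hnetm.sub hηm
  have hd1 : ∀ᵐ z ∂ρ, ‖net a θ z.1 - η z.1‖ ≤ 2 := by
    filter_upwards [hη1] with z hz
    refine (norm_sub_le _ _).trans ?_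
    have := net_abs_le a θ z.1
    simp only [Real.norm_eq_abs]
    linarith
  have hY1 : ∀ᵐ z ∂ρ, ‖z.2‖ ≤ 1 := by
    filter_upwards [hρ] with z hz
    rcases hz.2 with h | h <;> simp [h]
  have hYi : Integrable (fun z : (Fin d → ℝ) × ℝ => z.2) ρ :=
    Integrable.of_bound measurable_snd.aestronglyMeasurable 1 hY1
  have hdi : Integrable (fun z : (Fin d → ℝ) × ℝ => net a θ z.1 - η z.1) ρ :=
    Integrable.of_bound (hdm.mono comap_fst_le) 2 hd1
  have hηi : Integrable (fun z : (Fin d → ℝ) × ℝ => η z.1) ρ :=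
    Integrable.of_bound hηm' 1 (by simpa using hη1)
  have hdd : Integrable (fun z : (Fin d → ℝ) × ℝ => (net a θ z.1 - η z.1) ^ 2) ρ := by
    simp only [pow_two]
    exact hdi.bdd_mul (hdm.mono comap_fst_le) hd1
  have hdY : Integrable (fun z : (Fin d → ℝ) × ℝ => (net a θ z.1 - η z.1) * z.2) ρ :=
    hYi.bdd_mul (hdm.mono comap_fst_le) hd1
  have hdη : Integrable (fun z : (Fin d → ℝ) × ℝ => (net a θ z.1 - η z.1) * η z.1) ρ :=
    hηi.bdd_mul (hdm.mono comap_fst_le) hd1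
  -- The orthogonality: condition on `X` and pull the `X`-measurable factor out.
  have horth : ∫ z, (net a θ z.1 - η z.1) * z.2 ∂ρ = ∫ z, (net a θ z.1 - η z.1) * η z.1 ∂ρ := by
    have h := condExp_stronglyMeasurable_mul_of_bound₀ comap_fst_le hdm hYi 2 hd1
    rw [← integral_condExp comap_fst_le]
    refine integral_congr_ae ?_
    filter_upwards [h, hη] with z h1 h2
    rw [h2]
    exact h1.trans (by simp only [Pi.mul_apply, Pi.sub_apply]; rw [h2])
  have hηY : Integrable (fun z : (Fin d → ℝ) × ℝ => (η z.1 - z.2) ^ 2) ρ := by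
    have hb : ∀ᵐ z ∂ρ, ‖η z.1 - z.2‖ ≤ 2 := by
      filter_upwards [hη1, hY1] with z h1 h2
      refine (norm_sub_le _ _).trans ?_
      simp only [Real.norm_eq_abs] at h2 ⊢
      linarith
    simp only [pow_two]
    exact (hηi.sub hYi).bdd_mul (hηm'.sub measurable_snd.aestronglyMeasurable) hb
  have e : ∀ z : (Fin d → ℝ) × ℝ, (net a θ z.1 - z.2) ^ 2 = (net a θ z.1 - η z.1) ^ 2
      + (2 * ((net a θ z.1 - η z.1) * η z.1) - 2 * ((net a θ z.1 - η z.1) * z.2))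
      + (η z.1 - z.2) ^ 2 := fun z => by ring
  rw [sqRisk]
  simp only [e]
  have h2 := (hdη.const_mul 2).sub (hdY.const_mul 2)
  have e1 := integral_add (hdd.add h2) hηY
  have e2 := integral_add hdd h2
  have e3 := integral_sub (hdη.const_mul 2) (hdY.const_mul 2)
  simp only [Pi.add_apply, Pi.sub_apply] at e1 e2
  rw [e1, e2, e3, integral_const_mul, integral_const_mul, horth]
  ring

/-- Chebyshev's inequality for the distance of a network to the regression function. -/
lemma measureReal_le_abs_net_sub_le [IsProbabilityMeasure ρ]
    {η : (Fin d → ℝ) → ℝ} (hρ : IsBinaryLaw ρ)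
    (hη : IsRegressionFunction ρ η) (a : Arch d) (θ : Params a) {m : ℝ} (hm : 0 < m) :
    ρ.real {z | m ≤ |net a θ z.1 - η z.1|} ≤ (∫ z, (net a θ z.1 - η z.1) ^ 2 ∂ρ) / m ^ 2 := by
  have hηm' : AEStronglyMeasurable (fun z : (Fin d → ℝ) × ℝ => η z.1) ρ :=
    (aestronglyMeasurable_regression hη).mono comap_fst_le
  have hnm : AEStronglyMeasurable (fun z : (Fin d → ℝ) × ℝ => net a θ z.1) ρ :=
    ((continuous_net_right a θ).comp continuous_fst).aestronglyMeasurable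
  have hi : Integrable (fun z : (Fin d → ℝ) × ℝ => (net a θ z.1 - η z.1) ^ 2) ρ := by
    refine Integrable.of_bound ((hnm.sub hηm').pow 2) 4 ?_
    filter_upwards [ae_abs_regression_le hρ hη] with z hz
    have h1 := net_abs_le a θ z.1
    rw [Real.norm_of_nonneg (sq_nonneg _)]
    rw [abs_le] at hz h1
    nlinarith
  have h := mul_meas_ge_le_integral_of_nonneg (ae_of_all ρ fun z : (Fin d → ℝ) × ℝ =>
    sq_nonneg (net a θ z.1 - η z.1)) hi (m ^ 2)
  rw [le_div_iff₀ (by positivity), mul_comm]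
  have e : {z : (Fin d → ℝ) × ℝ | m ≤ |net a θ z.1 - η z.1|}
      = {z | m ^ 2 ≤ (net a θ z.1 - η z.1) ^ 2} := by
    ext z
    rw [Set.mem_ofPred_eq, Set.mem_ofPred_eq, ← sq_abs (net a θ z.1 - η z.1),
      pow_le_pow_iff_left₀ hm.le (abs_nonneg _) two_ne_zero]
  rw [e]
  exact h

/-- Where the two classifiers agree they err together, so only their disagreement counts. -/
lemma misRisk_sub_le [IsProbabilityMeasure ρ] (f g : (Fin d → ℝ) → ℝ) :
    misRisk ρ f - misRisk ρ g ≤ ρ.real {z | Real.sign (f z.1) ≠ Real.sign (g z.1)} := by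
  rw [sub_le_iff_le_add]
  refine (measureReal_mono ?_).trans (measureReal_union_le _ _)
  intro z hz
  by_cases h : Real.sign (f z.1) = Real.sign (g z.1)
  · exact Or.inr (by simpa [h] using hz)
  · exact Or.inl h

lemma sign_eq_of_abs_sub_lt {u v : ℝ} (h : |u - v| < |v|) : Real.sign u = Real.sign v := by
  rcases lt_trichotomy v 0 with hv | rfl | hv
  · rw [abs_of_neg hv, abs_lt] at h
    rw [Real.sign_of_neg hv, Real.sign_of_neg (by linarith)]
  · simp only [abs_zero] at h
    exact absurd h (abs_nonneg _).not_gt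
  · rw [abs_of_pos hv, abs_lt] at h
    rw [Real.sign_of_pos hv, Real.sign_of_pos (by linarith)]

/-- The excess risk of a network that is uniformly `m / 2`-close to an `L²`-approximation of the
regression function. -/
lemma misRisk_net_sub_le [IsProbabilityMeasure ρ] {η : (Fin d → ℝ) → ℝ} (hρ : IsBinaryLaw ρ)
    (hη : IsRegressionFunction ρ η) (a : Arch d) (θ θ₀ : Params a) {m : ℝ} (hm : 0 < m)
    (hθ : ∀ x ∈ cube d, |net a θ x - net a θ₀ x| ≤ m / 2) :
    misRisk ρ (net a θ) - misRisk ρ η ≤ ρ.real {z | |η z.1| ≤ m}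
      + 4 * (∫ z, (net a θ₀ z.1 - η z.1) ^ 2 ∂ρ) / m ^ 2 := by
  refine (misRisk_sub_le _ _).trans ?_
  have h1 : ρ.real {z | Real.sign (net a θ z.1) ≠ Real.sign (η z.1)} ≤
      ρ.real ({z | |η z.1| ≤ m} ∪ {z | m / 2 ≤ |net a θ₀ z.1 - η z.1|}) := by
    refine ENNReal.toReal_mono (measure_ne_top _ _) (measure_mono_ae ?_)
    filter_upwards [hρ] with z hz hs
    by_contra hcon
    have hcon' : z ∉ ({z | |η z.1| ≤ m} ∪ {z | m / 2 ≤ |net a θ₀ z.1 - η z.1|} : Set _) := hcon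
    simp only [Set.mem_union, Set.mem_ofPred_eq, not_or, not_le] at hcon'
    -- Here `|f - η| ≤ |f - f₀| + |f₀ - η| < m/2 + m/2 < |η|`, so the sign cannot change.
    refine hs (sign_eq_of_abs_sub_lt ?_)
    have := abs_sub_le (net a θ z.1) (net a θ₀ z.1) (η z.1)
    have := hθ z.1 hz.1
    linarith [hcon'.1, hcon'.2]
  refine h1.trans ((measureReal_union_le _ _).trans ?_)
  have h2 := measureReal_le_abs_net_sub_le hρ hη a θ₀ (half_pos hm)
  refine add_le_add le_rfl (h2.trans (le_of_eq ?_))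
  field_simp
  ring

end Population

/-! ### The empirical risk -/

/-- The unregularized empirical risk. -/
noncomputable def sqEmpRisk (z : ℕ → (Fin d → ℝ) × ℝ) (n : ℕ) (a : Arch d) (θ : Params a) : ℝ :=
  (1 / (n : ℝ)) * ∑ i ∈ Finset.range n, (net a θ (z i).1 - (z i).2) ^ 2

lemma empRisk_eq (z : ℕ → (Fin d → ℝ) × ℝ) (n : ℕ) (p lam : ℝ) (a : Arch d) (θ : Params a) :
    empRisk z n a p lam θ = sqEmpRisk z n a θ + lam / 2 * penalty a p θ := rfl

lemma continuous_sqEmpRisk (z : ℕ → (Fin d → ℝ) × ℝ) (n : ℕ) (a : Arch d) :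
    Continuous (sqEmpRisk z n a) :=
  continuous_const.mul (continuous_finsetSum _ fun i _ =>
    ((continuous_net_left a (z i).1).sub continuous_const).pow 2)

lemma sqEmpRisk_sub_abs_le {z : ℕ → (Fin d → ℝ) × ℝ}
    (hz : ∀ i, (z i).1 ∈ cube d ∧ ((z i).2 = 1 ∨ (z i).2 = -1)) {n : ℕ} (hn : 1 ≤ n)
    (a : Arch d) {θ θ' : Params a} {R : ℝ} (hθ : ‖θ‖ ≤ R) (hθ' : ‖θ'‖ ≤ R) :
    |sqEmpRisk z n a θ - sqEmpRisk z n a θ'|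
      ≤ 4 * (lipConst a.depth a.width R * ‖θ - θ'‖) := by
  have hn' : (0 : ℝ) < n := by exact_mod_cast hn
  rw [sqEmpRisk, sqEmpRisk, ← mul_sub, ← Finset.sum_sub_distrib, abs_mul,
    abs_of_pos (by positivity : (0 : ℝ) < 1 / n), one_div, inv_mul_le_iff₀ hn']
  refine (Finset.abs_sum_le_sum_abs _ _).trans ?_
  refine (Finset.sum_le_card_nsmul _ _ (4 * (lipConst a.depth a.width R * ‖θ - θ'‖))
    fun i _ => ?_).trans (by simp)
  refine (sqLoss_sub_abs_le (net_abs_le a θ _) (net_abs_le a θ' _) (hz i).2).trans ?_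
  exact mul_le_mul_of_nonneg_left (net_sub_abs_le a hθ hθ' (hz i).1) (by norm_num)

lemma ae_sample_mem {Ω : Type*} [MeasurableSpace Ω] {μ : Measure Ω}
    {ρ : Measure ((Fin d → ℝ) × ℝ)} {Z : ℕ → Ω → (Fin d → ℝ) × ℝ} (hρ : IsBinaryLaw ρ)
    (hZ : IsIIDSample μ ρ Z) :
    ∀ᵐ ω ∂μ, ∀ i, (Z i ω).1 ∈ cube d ∧ ((Z i ω).2 = 1 ∨ (Z i ω).2 = -1) := by
  refine ae_all_iff.2 fun i => ?_
  have h : ∀ᵐ z ∂ρ, z.1 ∈ cube d ∧ (z.2 = 1 ∨ z.2 = -1) := hρ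
  rw [← hZ.law i] at h
  exact ae_of_ae_map (hZ.measurable i).aemeasurable h

/-! ### Uniform concentration and consistency. -/

section Concentration

variable {Ω : Type*} [MeasurableSpace Ω] {μ : Measure Ω} [IsProbabilityMeasure μ]

/-- Hoeffding's inequality, two-sided, for averages of variables with values in `[0,4]`. -/
lemma measureReal_le_abs_average_sub_le {X : ℕ → Ω → ℝ} (hX : iIndepFun X μ)
    (hm : ∀ i, Measurable (X i)) (hb : ∀ i, ∀ᵐ ω ∂μ, X i ω ∈ Set.Icc (0 : ℝ) 4) {e : ℝ}
    (he : ∀ i, μ[X i] = e) {n : ℕ} (hn : 1 ≤ n) {u : ℝ} (hu : 0 ≤ u) :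
    μ.real {ω | u ≤ |(1 / (n : ℝ)) * (∑ i ∈ Finset.range n, X i ω) - e|}
      ≤ 2 * Real.exp (-(n * u ^ 2 / 8)) := by
  have hn' : (0 : ℝ) < n := by exact_mod_cast hn
  -- Hoeffding's lemma: the variance proxy is the squared half-length of `[0,4]`, which is `4`.
  have hsub : ∀ i, HasSubgaussianMGF (fun ω => X i ω - e) 4 μ := fun i => by
    have h := hasSubgaussianMGF_of_mem_Icc (hm i).aemeasurable (hb i)
    rw [he i] at h
    convert h using 1
    ext
    simp
    norm_num
  have hexp : -(n * u) ^ 2 / (2 * n * (4 : NNReal)) = -(n * u ^ 2 / 8) := by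
    push_cast
    field_simp
    ring
  have h1 := HasSubgaussianMGF.measure_sum_range_ge_le_of_iIndepFun
    (X := fun i ω => X i ω - e) (c := 4) (n := n) (ε := n * u)
    (hX.comp (fun _ x => x - e) fun _ => measurable_id.sub_const e)
    (fun i _ => hsub i) (by positivity)
  have h2 := HasSubgaussianMGF.measure_sum_range_ge_le_of_iIndepFun
    (X := fun i ω => -(X i ω - e)) (c := 4) (n := n) (ε := n * u)
    (hX.comp (fun _ x => -(x - e)) fun _ => (measurable_id.sub_const e).neg)
    (fun i _ => (hsub i).neg) (by positivity)
  rw [hexp] at h1 h2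
  refine (measureReal_mono (s₂ := {ω | n * u ≤ ∑ i ∈ Finset.range n, (X i ω - e)} ∪
    {ω | n * u ≤ ∑ i ∈ Finset.range n, -(X i ω - e)}) ?_).trans
    ((measureReal_union_le _ _).trans (by linarith))
  intro ω hω
  simp only [Set.mem_union, Set.mem_ofPred_eq, Finset.sum_neg_distrib, Finset.sum_sub_distrib,
    Finset.sum_const, Finset.card_range, nsmul_eq_mul] at hω ⊢
  have e1 : (∑ i ∈ Finset.range n, X i ω) - n * e
      = n * ((1 / (n : ℝ)) * (∑ i ∈ Finset.range n, X i ω) - e) := by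
    field_simp
  rw [e1, ← mul_neg, mul_le_mul_iff_right₀ hn', mul_le_mul_iff_right₀ hn']
  exact le_abs.1 hω

variable {ρ : Measure ((Fin d → ℝ) × ℝ)} {Z : ℕ → Ω → (Fin d → ℝ) × ℝ}

lemma measureReal_le_abs_sqEmpRisk_sub_le (hρ : IsBinaryLaw ρ) (hZ : IsIIDSample μ ρ Z)
    (a : Arch d) (θ : Params a) {n : ℕ} (hn : 1 ≤ n) {u : ℝ} (hu : 0 ≤ u) :
    μ.real {ω | u ≤ |sqEmpRisk (fun i => Z i ω) n a θ - sqRisk ρ a θ|}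
      ≤ 2 * Real.exp (-(n * u ^ 2 / 8)) := by
  refine measureReal_le_abs_average_sub_le
    (X := fun i ω => (net a θ (Z i ω).1 - (Z i ω).2) ^ 2)
    (hZ.indep.comp (fun _ z => (net a θ z.1 - z.2) ^ 2) fun _ => measurable_sqLoss a θ)
    (fun i => (measurable_sqLoss a θ).comp (hZ.measurable i)) (fun i => ?_) (fun i => ?_) hn hu
  · have h := ae_sqLoss_mem hρ a θ
    rw [← hZ.law i] at h
    exact ae_of_ae_map (hZ.measurable i).aemeasurable h
  · rw [sqRisk, ← hZ.law i, integral_map (hZ.measurable i).aemeasurable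
      (measurable_sqLoss a θ).aestronglyMeasurable]

/-- Uniform concentration of the empirical risk over the parametrizations bounded by `R`. -/
lemma exists_uniform_deviation_event [IsProbabilityMeasure ρ] (hρ : IsBinaryLaw ρ)
    (hZ : IsIIDSample μ ρ Z) (a : Arch d) {R h u : ℝ} (hR : 0 ≤ R) (hh : 0 < h) (hu : 0 ≤ u)
    {n : ℕ} (hn : 1 ≤ n) :
    ∃ B : Set Ω, MeasurableSet B ∧
      μ.real B ≤ (2 * R / h + 1) ^ (a.depth * (a.width ^ 2 + a.width))
        * (2 * Real.exp (-(n * u ^ 2 / 8))) ∧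
      ∀ᵐ ω ∂μ, ω ∉ B → ∀ θ : Params a, ‖θ‖ ≤ R →
        |sqEmpRisk (fun i => Z i ω) n a θ - sqRisk ρ a θ|
          < u + 8 * (lipConst a.depth a.width R * h) := by
  obtain ⟨C, hcard, hCR, hC⟩ := exists_finset_params_net a hR hh
  -- Union bound over the grid. Moving from `θ` to its grid point costs `4Λh` in each of the two
  -- risks, hence `8Λh`.
  refine ⟨⋃ c ∈ C, {ω | u ≤ |sqEmpRisk (fun i => Z i ω) n a c - sqRisk ρ a c|}, ?_, ?_, ?_⟩
  · refine Finset.measurableSet_biUnion _ fun c _ => ?_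
    refine measurableSet_le measurable_const (Measurable.abs (Measurable.sub_const ?_ _))
    refine Measurable.const_mul (Finset.measurable_fun_sum _ fun i _ => ?_) _
    exact (measurable_sqLoss a c).comp (hZ.measurable i)
  · refine (measureReal_biUnion_finset_le _ _).trans ?_
    refine (Finset.sum_le_card_nsmul _ _ _ fun c _ =>
      measureReal_le_abs_sqEmpRisk_sub_le hρ hZ a c hn hu).trans ?_
    rw [nsmul_eq_mul]
    exact mul_le_mul_of_nonneg_right hcard (by positivity)
  · filter_upwards [ae_sample_mem hρ hZ] with ω hω hB θ hθ
    obtain ⟨c, hc, hcθ⟩ := hC θ hθ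
    have h1 : |sqEmpRisk (fun i => Z i ω) n a c - sqRisk ρ a c| < u := by
      by_contra hcon
      exact hB (Set.mem_biUnion hc (not_lt.1 hcon))
    have h2 := sqEmpRisk_sub_abs_le hω hn a hθ (hCR c hc)
    have h3 := sqRisk_sub_abs_le hρ a (hCR c hc) hθ
    have hL := zero_le_one.trans (one_le_lipConst a.depth_pos (W := a.width) R)
    rw [norm_sub_rev] at h3
    have h4 : lipConst a.depth a.width R * ‖θ - c‖ ≤ lipConst a.depth a.width R * h :=
      mul_le_mul_of_nonneg_left hcθ hL
    rw [abs_lt] at h1 ⊢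
    rw [abs_le] at h2 h3
    constructor <;> linarith [h1.1, h1.2, h2.1, h2.2, h3.1, h3.2]

/-- Consistency: if almost surely the minimum-norm empirical risk minimizers are bounded by
`Rstar`, then some parametrization bounded by `Rstar` is as good as any other one. -/
lemma exists_norm_le_forall_sqRisk_le [IsProbabilityMeasure ρ] (hρ : IsBinaryLaw ρ)
    (hZ : IsIIDSample μ ρ Z) (a : Arch d) {Rstar : ℝ} (hRstar : 0 ≤ Rstar)
    (hA : BoundedMinimizers μ ρ Z a Rstar) (θ : Params a) :
    ∃ θs : Params a, ‖θs‖ ≤ Rstar ∧ sqRisk ρ a θs ≤ sqRisk ρ a θ := by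
  obtain ⟨θs, hθs, hmin⟩ := argminOn_nonempty (continuous_sqRisk hρ a)
    (isCompact_boundedParams a Rstar) (boundedParams_nonempty a hRstar)
  -- The best parametrization in the `Rstar` ball works: for each `τ` and one large `n`, compare it
  -- with `θ` through an empirical minimizer `θn` of norm at most `Rstar`. Both `θn` and `θ` lie in
  -- the ball of radius `R`, where the two risks differ by less than `τ/2`.
  refine ⟨θs, hθs, le_of_forall_pos_le_add fun τ hτ => ?_⟩
  set R := max Rstar ‖θ‖
  have hR : 0 ≤ R := hRstar.trans (le_max_left _ _)
  set Λ := lipConst a.depth a.width R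
  have hΛ : 0 < Λ := zero_lt_one.trans_le (one_le_lipConst a.depth_pos R)
  set h := τ / (32 * Λ)
  have hh : 0 < h := by positivity
  set A := (2 * R / h + 1) ^ (a.depth * (a.width ^ 2 + a.width))
  have hlim : Tendsto (fun n : ℕ => A * (2 * Real.exp (-(n * (τ / 4) ^ 2 / 8)))) atTop (nhds 0) := by
    have h1 : Tendsto (fun n : ℕ => (n : ℝ) * ((τ / 4) ^ 2 / 8)) atTop atTop :=
      tendsto_natCast_atTop_atTop.atTop_mul_const (by positivity)
    have h2 := (Real.tendsto_exp_neg_atTop_nhds_zero.comp h1).const_mul (A * 2)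
    rw [mul_zero] at h2
    refine h2.congr fun n => ?_
    simp only [Function.comp_apply, mul_assoc, mul_div_assoc]
  obtain ⟨n, hn1, hnA⟩ := ((eventually_ge_atTop 1).and
    (hlim.eventually (gt_mem_nhds one_pos))).exists
  obtain ⟨B, hBm, hB, hdev⟩ := exists_uniform_deviation_event hρ hZ a hR hh
    (by positivity : 0 ≤ τ / 4) hn1
  -- A single good sample suffices, since the conclusion is deterministic; the bad event only has to
  -- miss a set of positive probability.
  have hBc : μ Bᶜ ≠ 0 := by
    intro h0
    have h1 := measureReal_compl (μ := μ) hBm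
    rw [measureReal_def, h0] at h1
    simp at h1
    linarith
  obtain ⟨ω, hωB, hω1, hω2⟩ := (frequently_ae_mem_iff.2 hBc).and_eventually
    (hdev.and hA.2) |>.exists
  obtain ⟨hne, hbd⟩ := hω2 n hn1
  have hemp : ∀ θ : Params a, empRisk (fun i => Z i ω) n a 1 0 θ
      = sqEmpRisk (fun i => Z i ω) n a θ := fun θ => by simp [empRisk_eq]
  -- Closedness gives a minimizer nearest to the origin, that is, of smallest norm, to which the
  -- bound `Rstar` applies.
  have hcl : IsClosed (argminOn (empRisk (fun i => Z i ω) n a 1 0) Set.univ) := by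
    have : argminOn (empRisk (fun i => Z i ω) n a 1 0) Set.univ
        = ⋂ θ', {θ | sqEmpRisk (fun i => Z i ω) n a θ ≤ sqEmpRisk (fun i => Z i ω) n a θ'} := by
      ext θ
      simp [argminOn, hemp]
    rw [this]
    exact isClosed_iInter fun θ' => isClosed_le (continuous_sqEmpRisk _ n a) continuous_const
  obtain ⟨θn, hθn, hdist⟩ := hcl.exists_infDist_eq_dist hne 0
  have hθnR : ‖θn‖ ≤ Rstar := by
    refine hbd θn ⟨hθn, fun θ' hθ' => ?_⟩
    have := Metric.infDist_le_dist_of_mem (x := (0 : Params a)) hθ'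
    rw [hdist] at this
    simpa using this
  have h1 := hω1 hωB θn (hθnR.trans (le_max_left _ _))
  have h2 := hω1 hωB θ (le_max_right _ _)
  have h3 := hθn.2 θ (Set.mem_univ _)
  rw [hemp, hemp] at h3
  have h4 := hmin θn hθnR
  have h5 : 8 * (Λ * h) = τ / 4 := by
    simp only [h]
    field_simp
    norm_num
  rw [h5] at h1 h2
  rw [abs_lt] at h1 h2
  linarith [h1.1, h2.2]

end Concentration

/-! ### The constant of the well-separation condition is bounded -/

/-- The parallelogram law for the constant networks `b`, `-b`, `0`. It shows that these three cannot
all be nearly optimal. -/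
lemma sqRisk_constParams_add {ρ : Measure ((Fin d → ℝ) × ℝ)} [IsProbabilityMeasure ρ]
    (hρ : IsBinaryLaw ρ) (a : Arch d) {b : ℝ} (hb : |b| ≤ 1) :
    sqRisk ρ a (constParams a b) + sqRisk ρ a (constParams a (-b))
      = 2 * sqRisk ρ a (constParams a 0) + 2 * b ^ 2 := by
  have i1 := integrable_sqLoss hρ a (constParams a b)
  have i2 := integrable_sqLoss hρ a (constParams a (-b))
  have i3 := (integrable_sqLoss hρ a (constParams a 0)).const_mul 2
  have e : ∀ z : (Fin d → ℝ) × ℝ, (net a (constParams a b) z.1 - z.2) ^ 2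
      + (net a (constParams a (-b)) z.1 - z.2) ^ 2
      = 2 * (net a (constParams a 0) z.1 - z.2) ^ 2 + 2 * b ^ 2 := fun z => by
    rw [net_constParams a hb, net_constParams a (by rwa [abs_neg]), net_constParams a (by simp)]
    ring
  rw [sqRisk, sqRisk, sqRisk, ← integral_add i1 i2, ← integral_const_mul]
  simp only [e]
  rw [integral_add i3 (integrable_const _)]
  simp

/-- If some admissible parametrization is at distance `t` from the minimizers, then `K t^r` is at
most the largest possible risk. For small `t` there must be one: otherwise the constant networks
`b`, `-b`, `0` would all be close to minimizers, against the strict convexity of the square loss. -/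
lemma exists_forall_wellSeparated_const_le (d L W : ℕ) (hL : 1 ≤ L) {p R : ℝ} (hp : 0 < p)
    (hR : 0 < R) (lamTop r : ℝ) :
    ∃ Kmax : ℝ, ∀ (a : Arch d) (ρ : Measure ((Fin d → ℝ) × ℝ)) [IsProbabilityMeasure ρ] (lam K : ℝ),
      a.depth = L → a.width = W → IsBinaryLaw ρ → 0 ≤ lam → lam ≤ lamTop →
      WellSeparated ρ a p R lam K r → K ≤ Kmax := by
  set Λ := lipConst L W R with hΛ_def
  have hΛ : 0 < Λ := zero_lt_one.trans_le (one_le_lipConst hL R)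
  set P : ℝ := L * ((W : ℝ) ^ 2 + W) with hP_def
  have hP : 0 ≤ P := by positivity
  set b := min R 1 with hb_def
  have hb : 0 < b := lt_min hR one_pos
  have hb1 : |b| ≤ 1 := by rw [abs_of_pos hb]; exact min_le_right _ _
  -- `t^p ≤ v` makes the penalty of a minimizer of norm at most `t` cost at most `b²/4`; `t ≤
  -- b²/(32Λ)` keeps the Lipschitz errors of the three comparisons, `16Λt` in total, below `b²/2`.
  set v := b ^ 2 / (2 * (|lamTop| * P + 1)) with hv_def
  have hv : 0 < v := by positivity
  set t := min (b ^ 2 / (32 * Λ)) (v ^ (1 / p)) with ht_def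
  have ht : 0 < t := lt_min (by positivity) (by positivity)
  have htΛ : 16 * (Λ * t) ≤ b ^ 2 / 2 := by
    have := min_le_left (b ^ 2 / (32 * Λ)) (v ^ (1 / p))
    rw [← ht_def, le_div_iff₀ (by positivity)] at this
    linarith
  have htp : t ^ p ≤ v := by
    calc t ^ p ≤ (v ^ (1 / p)) ^ p := Real.rpow_le_rpow ht.le (min_le_right _ _) hp.le
      _ = v := by rw [one_div, Real.rpow_inv_rpow hv.le hp.ne']
  have htr : 0 < t ^ r := Real.rpow_pos_of_pos ht r
  refine ⟨(4 + lamTop / 2 * (P * R ^ p)) / t ^ r, ?_⟩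
  intro a ρ _ lam K haL haW hρ hlam hlamTop hsep
  obtain ⟨θm, hθm⟩ := argminOn_nonempty (continuous_popRisk hρ a hp lam)
    (isCompact_boundedParams a R) (boundedParams_nonempty a hR.le)
  have hlip : ∀ {θ θ' : Params a}, ‖θ‖ ≤ R → ‖θ'‖ ≤ R → dist θ θ' < t →
      |sqRisk ρ a θ - sqRisk ρ a θ'| ≤ 4 * (Λ * t) := by
    intro θ θ' h1 h2 h3
    refine (sqRisk_sub_abs_le hρ a h1 h2).trans ?_
    rw [← dist_eq_norm, show lipConst a.depth a.width R = Λ by rw [haL, haW]]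
    gcongr
  by_cases hfar : ∃ θ ∈ boundedParams a R,
      t ≤ Metric.infDist θ (argminOn (popRisk ρ a p lam) (boundedParams a R))
  · obtain ⟨θ, hθ, hθt⟩ := hfar
    have h1 := hsep t ht θm hθm θ hθ hθt
    have h2 : 0 ≤ popRisk ρ a p lam θm :=
      add_nonneg (sqRisk_nonneg ρ a θm) (mul_nonneg (by positivity) (penalty_nonneg a p θm))
    have h3 : popRisk ρ a p lam θ ≤ 4 + lamTop / 2 * (P * R ^ p) := by
      rw [popRisk_eq]
      refine add_le_add (sqRisk_le hρ a θ) ?_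
      have h4 := penalty_le a hp (show ‖θ‖ ≤ R from hθ)
      rw [haL, haW] at h4
      exact mul_le_mul (by linarith) h4 (penalty_nonneg a p θ) (by linarith)
    rw [le_div_iff₀ htr]
    linarith
  -- Adding the optimality of `θ1` and `θ2` against `θ0` gives `2b² ≤ 2 · b²/4 + 16Λt ≤ b²`.
  · exfalso
    push Not at hfar
    have hnear : ∀ c : ℝ, |c| ≤ b → ∃ θ ∈ argminOn (popRisk ρ a p lam) (boundedParams a R),
        dist (constParams a c) θ < t ∧ ‖constParams a c‖ ≤ R := by
      intro c hc
      have hcR : ‖constParams a c‖ ≤ R :=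
        (norm_constParams_le a c).trans (hc.trans (min_le_left _ _))
      obtain ⟨θ, h1, h2⟩ := (Metric.infDist_lt_iff ⟨θm, hθm⟩).1 (hfar _ hcR)
      exact ⟨θ, h1, h2, hcR⟩
    obtain ⟨θ1, hm1, hd1, hR1⟩ := hnear b (by rw [abs_of_pos hb])
    obtain ⟨θ2, hm2, hd2, hR2⟩ := hnear (-b) (by rw [abs_neg, abs_of_pos hb])
    obtain ⟨θ0, hm0, hd0, hR0⟩ := hnear 0 (by rw [abs_zero]; exact hb.le)
    have l1 := abs_le.1 (hlip hR1 hm1.1 hd1)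
    have l2 := abs_le.1 (hlip hR2 hm2.1 hd2)
    have l0 := abs_le.1 (hlip hR0 hm0.1 hd0)
    have hn0 : ‖θ0‖ ≤ t := by
      have h0 : constParams a 0 = 0 := by
        have := norm_constParams_le a 0
        rw [abs_zero] at this
        exact norm_le_zero_iff.1 this
      rw [h0, dist_zero_left] at hd0
      exact hd0.le
    have p0 : lam / 2 * penalty a p θ0 ≤ b ^ 2 / 4 := by
      have h4 := penalty_le a hp hn0
      rw [haL, haW, ← hP_def] at h4
      have h5 : lam ≤ |lamTop| := hlamTop.trans (le_abs_self _)
      calc lam / 2 * penalty a p θ0 ≤ |lamTop| / 2 * (P * v) := by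
            refine mul_le_mul (by linarith) (h4.trans ?_) (penalty_nonneg a p θ0) (by positivity)
            exact mul_le_mul_of_nonneg_left htp hP
        _ = (|lamTop| * P) / (|lamTop| * P + 1) * (b ^ 2 / 4) := by
            rw [hv_def]
            field_simp
            ring
        _ ≤ b ^ 2 / 4 := by
            refine mul_le_of_le_one_left (by positivity) ((div_le_one (by positivity)).2 ?_)
            linarith
    have p1 : 0 ≤ lam / 2 * penalty a p θ1 := mul_nonneg (by linarith) (penalty_nonneg a p θ1)
    have p2 : 0 ≤ lam / 2 * penalty a p θ2 := mul_nonneg (by linarith) (penalty_nonneg a p θ2)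
    have e1 := hm1.2 θ0 hm0.1
    have e2 := hm2.2 θ0 hm0.1
    rw [popRisk_eq, popRisk_eq] at e1 e2
    have hadd := sqRisk_constParams_add hρ a hb1
    have hb2 : 0 < b ^ 2 := by positivity
    linarith [l1.2, l2.2, l0.1]

/-! ### The excess risk for a fixed sample size -/

section Excess

variable {Ω : Type*} [MeasurableSpace Ω] {μ : Measure Ω} [IsProbabilityMeasure μ]
  {ρ : Measure ((Fin d → ℝ) × ℝ)} [IsProbabilityMeasure ρ]
  {Z : ℕ → Ω → (Fin d → ℝ) × ℝ}

omit [IsProbabilityMeasure ρ] in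
lemma misRisk_nonneg (f : (Fin d → ℝ) → ℝ) : 0 ≤ misRisk ρ f := measureReal_nonneg

lemma misRisk_le_one (f : (Fin d → ℝ) → ℝ) : misRisk ρ f ≤ 1 := measureReal_le_one

/-- The `L²` distance to the regression function of a regularized population risk minimizer. -/
lemma integral_net_sub_sq_le {η : (Fin d → ℝ) → ℝ} (hρ : IsBinaryLaw ρ)
    (hη : IsRegressionFunction ρ η) (a : Arch d) {p lam R ε : ℝ} (hlam : 0 ≤ lam)
    {θa θs θ₀ : Params a} (ha : ∀ x ∈ cube d, |net a θa x - η x| ≤ ε)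
    (hsR : ‖θs‖ ≤ R) (hsa : sqRisk ρ a θs ≤ sqRisk ρ a θa)
    (hpen : lam / 2 * penalty a p θs ≤ ε ^ 2 / 2)
    (h0 : θ₀ ∈ argminOn (popRisk ρ a p lam) (boundedParams a R)) :
    ∫ z, (net a θ₀ z.1 - η z.1) ^ 2 ∂ρ ≤ 3 / 2 * ε ^ 2 := by
  -- Compare with `θs`: the noise term cancels, leaving `ε²` from the approximation and `ε²/2` from
  -- the penalty.
  have h1 := h0.2 θs hsR
  rw [popRisk_eq, popRisk_eq] at h1
  have h2 : 0 ≤ lam / 2 * penalty a p θ₀ := mul_nonneg (by linarith) (penalty_nonneg a p θ₀)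
  have h3 := sqRisk_eq_add hρ hη a θ₀
  have h4 := sqRisk_eq_add hρ hη a θa
  have h5 : ∫ z, (net a θa z.1 - η z.1) ^ 2 ∂ρ ≤ ε ^ 2 := by
    refine (le_abs_self _).trans ?_
    rw [← Real.norm_eq_abs]
    refine (norm_integral_le_of_norm_le_const (C := ε ^ 2) ?_).trans (by simp)
    filter_upwards [hρ] with z hz
    rw [Real.norm_of_nonneg (sq_nonneg _)]
    exact sq_le_sq' (abs_le.1 (ha z.1 hz.1)).1 (abs_le.1 (ha z.1 hz.1)).2
  linarith

/-- An empirical risk minimizer is close to the population risk minimizers if the risks are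
uniformly close. -/
lemma exists_argmin_dist_lt (hρ : IsBinaryLaw ρ) {a : Arch d} {p lam R K r t : ℝ} (hp : 0 < p)
    (hR : 0 ≤ R) (ht : 0 < t) (hsep : WellSeparated ρ a p R lam K r)
    {z : ℕ → (Fin d → ℝ) × ℝ} {n : ℕ}
    (hdev : ∀ θ : Params a, ‖θ‖ ≤ R → |sqEmpRisk z n a θ - sqRisk ρ a θ| < K * t ^ r / 2)
    {θ : Params a} (hθ : θ ∈ argminOn (empRisk z n a p lam) (boundedParams a R)) :
    ∃ θ₀ ∈ argminOn (popRisk ρ a p lam) (boundedParams a R), dist θ θ₀ < t := by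
  obtain ⟨θm, hθm⟩ := argminOn_nonempty (continuous_popRisk hρ a hp lam)
    (isCompact_boundedParams a R) (boundedParams_nonempty a hR)
  rw [← Metric.infDist_lt_iff ⟨θm, hθm⟩]
  by_contra hcon
  have h1 := hsep t ht θm hθm θ hθ.1 (not_lt.1 hcon)
  have h2 := hθ.2 θm hθm.1
  have h3 := abs_lt.1 (hdev θ hθ.1)
  have h4 := abs_lt.1 (hdev θm hθm.1)
  rw [popRisk_eq, popRisk_eq] at h1
  rw [empRisk_eq, empRisk_eq] at h2
  linarith [h3.1, h4.2]

/-- On the good event the deterministic estimates apply; on the bad event the excess risk is bounded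
by one, so its probability is added. -/
lemma integral_misRisk_sub_le {η : (Fin d → ℝ) → ℝ} (hρ : IsBinaryLaw ρ)
    (hZ : IsIIDSample μ ρ Z) (hη : IsRegressionFunction ρ η) (a : Arch d)
    {p lam R K r m ε : ℝ} (hp : 0 < p) (hR : 0 ≤ R) (hlam : 0 ≤ lam) (hK : 0 < K) (hm : 0 < m)
    {θa θs : Params a} (ha : ∀ x ∈ cube d, |net a θa x - η x| ≤ ε)
    (hsR : ‖θs‖ ≤ R) (hsa : sqRisk ρ a θs ≤ sqRisk ρ a θa)
    (hpen : lam / 2 * penalty a p θs ≤ ε ^ 2 / 2) (hsep : WellSeparated ρ a p R lam K r)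
    {n : ℕ} (hn : 1 ≤ n) {θhat : Ω → Params a}
    (hθhat : ∀ᵐ ω ∂μ, θhat ω ∈ minNormERM (fun i => Z i ω) n a p lam R) {Λ : ℝ}
    (hΛ : Λ = lipConst a.depth a.width R) :
    (∫ ω, misRisk ρ (net a (θhat ω)) ∂μ) - misRisk ρ η ≤
      ρ.real {z | |η z.1| ≤ m} + 6 * ε ^ 2 / m ^ 2
        + (64 * R * Λ / (K * (m / (2 * Λ)) ^ r) + 1) ^ (a.depth * (a.width ^ 2 + a.width))
          * (2 * Real.exp (-(n * (K * (m / (2 * Λ)) ^ r) ^ 2 / 128))) := by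
  have hΛ0 : 0 < Λ := hΛ ▸ zero_lt_one.trans_le (one_le_lipConst a.depth_pos R)
  set t := m / (2 * Λ) with ht_def
  have ht : 0 < t := by positivity
  set κ := K * t ^ r with hκ_def
  have hκ : 0 < κ := mul_pos hK (Real.rpow_pos_of_pos ht r)
  -- The level `κ/4` and the grid error `8Λ · κ/(32Λ) = κ/4` add up to the deviation `κ/2` that
  -- well-separation tolerates.
  obtain ⟨B, hBm, hB, hdev⟩ := exists_uniform_deviation_event hρ hZ a hR
    (by positivity : 0 < κ / (32 * Λ)) (by positivity : 0 ≤ κ / 4) hn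
  set β := ρ.real {z | |η z.1| ≤ m} + 6 * ε ^ 2 / m ^ 2 with hβ_def
  have hβ : 0 ≤ β := by positivity
  have hgood : ∀ᵐ ω ∂μ, misRisk ρ (net a (θhat ω)) ≤
      misRisk ρ η + β + B.indicator (fun _ => (1 : ℝ)) ω := by
    filter_upwards [hdev, hθhat] with ω hω hhat
    by_cases hωB : ω ∈ B
    · rw [Set.indicator_of_mem hωB]
      have := misRisk_le_one (ρ := ρ) (net a (θhat ω))
      have := misRisk_nonneg (ρ := ρ) η
      linarith
    · rw [Set.indicator_of_notMem hωB, add_zero]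
      have hsum : κ / 4 + 8 * (lipConst a.depth a.width R * (κ / (32 * Λ))) = κ / 2 := by
        rw [← hΛ]
        field_simp
        norm_num
      have hdev' := hω hωB
      rw [hsum] at hdev'
      obtain ⟨θ₀, hθ₀, hdist⟩ := exists_argmin_dist_lt hρ hp hR ht hsep hdev' hhat.1
      have hclose : ∀ x ∈ cube d, |net a (θhat ω) x - net a θ₀ x| ≤ m / 2 := by
        intro x hx
        refine (net_sub_abs_le a hhat.1.1 hθ₀.1 hx).trans ?_
        rw [← hΛ, ← dist_eq_norm]
        refine (mul_le_mul_of_nonneg_left hdist.le hΛ0.le).trans (le_of_eq ?_)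
        rw [ht_def]
        field_simp
      have h1 := misRisk_net_sub_le hρ hη a (θhat ω) θ₀ hm hclose
      have h2 := integral_net_sub_sq_le hρ hη a hlam ha hsR hsa hpen hθ₀
      have h3 : 4 * (∫ z, (net a θ₀ z.1 - η z.1) ^ 2 ∂ρ) / m ^ 2 ≤ 6 * ε ^ 2 / m ^ 2 := by
        exact div_le_div_of_nonneg_right (by linarith) (by positivity)
      linarith
  have hind : Integrable (B.indicator fun _ => (1 : ℝ)) μ := (integrable_const 1).indicator hBm
  have hint : ∫ ω, misRisk ρ (net a (θhat ω)) ∂μ ≤ misRisk ρ η + β + μ.real B := by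
    refine (integral_mono_of_nonneg (ae_of_all _ fun ω => misRisk_nonneg _)
      ((integrable_const _).add hind) hgood).trans (le_of_eq ?_)
    have e := integral_add (integrable_const (μ := μ) (misRisk ρ η + β)) hind
    have e2 := integral_indicator_one (μ := μ) hBm
    simp only [Pi.add_apply]
    rw [e]
    simp only [integral_const, probReal_univ, one_smul]
    congr 1
  have e1 : 2 * R / (κ / (32 * Λ)) = 64 * R * Λ / κ := by
    field_simp
    ring
  have e2 : (n : ℝ) * (κ / 4) ^ 2 / 8 = n * κ ^ 2 / 128 := by ring
  rw [e1, e2] at hB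
  linarith

end Excess

/-! ### Sequences bounded by a power -/

/-- `u n` is at most a constant times `n ^ e` for all `n ≥ 1`. -/
def PowLE (u : ℕ → ℝ) (e : ℝ) : Prop :=
  ∃ c : ℝ, 0 < c ∧ ∀ n : ℕ, 1 ≤ n → u n ≤ c * (n : ℝ) ^ e

namespace PowLE

variable {u v : ℕ → ℝ} {e f : ℝ}

lemma one_le_cast_rpow {n : ℕ} (hn : 1 ≤ n) (he : 0 ≤ e) : (1 : ℝ) ≤ (n : ℝ) ^ e :=
  Real.one_le_rpow (by exact_mod_cast hn) he

lemma mono (hv : PowLE v e) (h : ∀ n, 1 ≤ n → u n ≤ v n) : PowLE u e := by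
  obtain ⟨c, hc, hv⟩ := hv
  exact ⟨c, hc, fun n hn => (h n hn).trans (hv n hn)⟩

lemma const (c : ℝ) (he : 0 ≤ e) : PowLE (fun _ => c) e := by
  refine ⟨|c| + 1, by positivity, fun n hn => ?_⟩
  have h := one_le_cast_rpow hn he
  have := le_abs_self c
  nlinarith [abs_nonneg c]

lemma add (hu : PowLE u e) (hv : PowLE v e) : PowLE (fun n => u n + v n) e := by
  obtain ⟨c, hc, hu⟩ := hu
  obtain ⟨c', hc', hv⟩ := hv
  refine ⟨c + c', by positivity, fun n hn => ?_⟩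
  rw [add_mul]
  exact add_le_add (hu n hn) (hv n hn)

lemma mul (hu : PowLE u e) (hv : PowLE v f) (hv0 : ∀ n, 1 ≤ n → 0 ≤ v n) :
    PowLE (fun n => u n * v n) (e + f) := by
  obtain ⟨c, hc, hu⟩ := hu
  obtain ⟨c', hc', hv⟩ := hv
  refine ⟨c * c', by positivity, fun n hn => ?_⟩
  have hn' : (0 : ℝ) < n := by exact_mod_cast hn
  rw [Real.rpow_add hn']
  calc u n * v n ≤ (c * (n : ℝ) ^ e) * (c' * (n : ℝ) ^ f) :=
        mul_le_mul (hu n hn) (hv n hn) (hv0 n hn) (by positivity)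
    _ = _ := by ring

lemma rpow (hu : PowLE u e) (hu0 : ∀ n, 1 ≤ n → 0 ≤ u n) {k : ℝ} (hk : 0 ≤ k) :
    PowLE (fun n => u n ^ k) (e * k) := by
  obtain ⟨c, hc, hu⟩ := hu
  refine ⟨c ^ k, by positivity, fun n hn => ?_⟩
  rw [Real.rpow_mul (Nat.cast_nonneg n), ← Real.mul_rpow hc.le (by positivity)]
  exact Real.rpow_le_rpow (hu0 n hn) (hu n hn) hk

/-- A logarithm costs an arbitrarily small power, so logarithmic factors are paid for by strict
inequalities between exponents. -/
lemma log (hu : PowLE u e) (hu1 : ∀ n, 1 ≤ n → 1 ≤ u n) (hf : 0 < f) :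
    PowLE (fun n => Real.log (u n)) f := by
  obtain ⟨c, hc, hu⟩ := hu
  have h : PowLE (fun n => Real.log c + |e| * ((n : ℝ) ^ f / f)) f := by
    refine (const _ hf.le).add ⟨|e| / f + 1, by positivity, fun n _ => ?_⟩
    have : 0 ≤ (n : ℝ) ^ f := by positivity
    calc |e| * ((n : ℝ) ^ f / f) = |e| / f * (n : ℝ) ^ f := by ring
      _ ≤ _ := by nlinarith
  refine h.mono fun n hn => ?_
  have hn' : (0 : ℝ) < n := by exact_mod_cast hn
  have hn1 : (1 : ℝ) ≤ n := by exact_mod_cast hn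
  calc Real.log (u n) ≤ Real.log (c * (n : ℝ) ^ e) :=
        Real.log_le_log (zero_lt_one.trans_le (hu1 n hn)) (hu n hn)
    _ = Real.log c + e * Real.log n := by
        rw [Real.log_mul hc.ne' (by positivity), Real.log_rpow hn']
    _ ≤ Real.log c + |e| * ((n : ℝ) ^ f / f) := by
        refine add_le_add le_rfl (mul_le_mul (le_abs_self e) ?_ (Real.log_nonneg hn1)
          (abs_nonneg e))
        exact Real.log_le_rpow_div hn'.le hf

lemma eventually_le (hu : PowLE u e) (hef : e < f) : ∀ᶠ n : ℕ in atTop, u n ≤ (n : ℝ) ^ f := by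
  obtain ⟨c, hc, hu⟩ := hu
  have h : Tendsto (fun n : ℕ => (n : ℝ) ^ (f - e)) atTop atTop :=
    (tendsto_rpow_atTop (sub_pos.2 hef)).comp tendsto_natCast_atTop_atTop
  filter_upwards [h.eventually_ge_atTop c, eventually_ge_atTop 1] with n h1 hn
  have hn' : (0 : ℝ) < n := by exact_mod_cast hn
  calc u n ≤ c * (n : ℝ) ^ e := hu n hn
    _ ≤ (n : ℝ) ^ (f - e) * (n : ℝ) ^ e := by gcongr
    _ = (n : ℝ) ^ f := by rw [← Real.rpow_add hn']; ring_nf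

lemma isSoftO (hu : PowLE u e) (hu0 : ∀ n, 1 ≤ n → 0 ≤ u n) : IsSoftO u e := by
  obtain ⟨c, hc, hu⟩ := hu
  refine ⟨0, IsBigO.of_bound c ?_⟩
  filter_upwards [eventually_ge_atTop 1] with n hn
  rw [pow_zero, mul_one, Real.norm_of_nonneg (hu0 n hn),
    Real.norm_of_nonneg (Real.rpow_nonneg (Nat.cast_nonneg n) e)]
  exact hu n hn

end PowLE

/-! ### Growth of the network family -/

variable {s L₀ : ℕ} {p r α M Rstar : ℝ}

lemma const3_pos (hs : 1 ≤ s) (hM : 0 < M) : 0 < const3 d s M := by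
  have : (0 : ℝ) < s := by exact_mod_cast hs
  unfold const3
  positivity

lemma two_le_baseWidth (d s L₀ : ℕ) (r α M : ℝ) (n : ℕ) : 2 ≤ baseWidth d s L₀ r α M n :=
  le_max_left _ _

lemma one_le_const1 (hd : 1 ≤ d) (hs : 1 ≤ s) : 1 ≤ const1 d s := by
  have h1 : (1 : ℝ) ≤ d := by exact_mod_cast hd
  have h2 : (1 : ℝ) ≤ s := by exact_mod_cast hs
  exact one_le_mul_of_one_le_of_one_le (one_le_pow₀ (by linarith)) h1

lemma one_le_logb_two {w : ℕ} (hw : 2 ≤ w) : 1 ≤ Real.logb 2 w := by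
  rw [Real.le_logb_iff_rpow_le one_lt_two (by positivity), Real.rpow_one]
  exact_mod_cast hw

lemma le_widthOf (hd : 1 ≤ d) (hs : 1 ≤ s) {w : ℕ} (hw : 2 ≤ w) : (w : ℝ) ≤ widthOf d s w := by
  refine le_trans ?_ (Nat.le_ceil _)
  have h1 := one_le_const1 hd hs
  have h2 := one_le_logb_two hw
  have h3 : (0 : ℝ) ≤ w := Nat.cast_nonneg w
  calc (w : ℝ) ≤ w * Real.logb 2 w := le_mul_of_one_le_right h3 h2
    _ ≤ _ := le_mul_of_one_le_left (by positivity) h1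

/-- The real number that is rounded up in the definition of `baseWidth`. -/
lemma baseWidth_arg_eq (L₀ : ℕ) (hs : 1 ≤ s) (hM : 0 < M) {n : ℕ} (hn : 1 ≤ n) :
    (L₀ : ℝ)⁻¹ * ((n : ℝ) ^ (-(α / r)) / const3 d s M) ^ (-((d : ℝ) / (2 * s)))
      = ((L₀ : ℝ)⁻¹ * const3 d s M ^ ((d : ℝ) / (2 * s))) * (n : ℝ) ^ (α * d / (2 * r * s)) := by
  have hn' : (0 : ℝ) < n := by exact_mod_cast hn
  have hC := const3_pos (d := d) hs hM
  rw [Real.div_rpow (by positivity) hC.le, ← Real.rpow_mul hn'.le, Real.rpow_neg hC.le,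
    div_inv_eq_mul, show -(α / r) * -((d : ℝ) / (2 * s)) = α * d / (2 * r * s) by
      rw [neg_mul_neg, div_mul_div_comm]; ring_nf]
  ring

lemma exists_le_widthSeq (hd : 1 ≤ d) (hs : 1 ≤ s) (hL : 2 ≤ L₀) (hM : 0 < M) :
    ∃ c : ℝ, 0 < c ∧ ∀ n : ℕ, 1 ≤ n →
      c * (n : ℝ) ^ (α * d / (2 * r * s)) ≤ widthSeq d s L₀ r α M n := by
  have hC := const3_pos (d := d) hs hM
  have hL' : (0 : ℝ) < L₀ := by exact_mod_cast (by omega : 0 < L₀)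
  refine ⟨(L₀ : ℝ)⁻¹ * const3 d s M ^ ((d : ℝ) / (2 * s)), by positivity, fun n hn => ?_⟩
  refine le_trans ?_ (le_widthOf hd hs (two_le_baseWidth d s L₀ r α M n))
  rw [← baseWidth_arg_eq L₀ hs hM hn]
  refine (Nat.le_ceil _).trans ?_
  exact Nat.cast_le.2 (le_max_right _ _)

lemma one_le_widthSeq (hd : 1 ≤ d) (hs : 1 ≤ s) (n : ℕ) :
    (1 : ℝ) ≤ widthSeq d s L₀ r α M n := by
  refine le_trans ?_ (le_widthOf hd hs (two_le_baseWidth d s L₀ r α M n))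
  exact_mod_cast one_le_two.trans (two_le_baseWidth d s L₀ r α M n)

lemma powLE_baseWidth (hs : 1 ≤ s) (hL : 2 ≤ L₀) (hr : 1 < r) (hα : 0 < α) (hM : 0 < M) :
    PowLE (fun n => (baseWidth d s L₀ r α M n : ℝ)) (α * d / (2 * r * s)) := by
  have hC := const3_pos (d := d) hs hM
  have hL' : (0 : ℝ) < L₀ := by exact_mod_cast (by omega : 0 < L₀)
  have hr0 : 0 < r := by linarith
  have he : 0 ≤ α * d / (2 * r * s) := by positivity
  have h : PowLE (fun n : ℕ => ((L₀ : ℝ)⁻¹ * const3 d s M ^ ((d : ℝ) / (2 * s)))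
      * (n : ℝ) ^ (α * d / (2 * r * s)) + 3) (α * d / (2 * r * s)) :=
    PowLE.add ⟨_, by positivity, fun n _ => le_rfl⟩ (PowLE.const 3 he)
  refine h.mono fun n hn => ?_
  rw [← baseWidth_arg_eq L₀ hs hM hn, baseWidth, Nat.cast_max]
  have h0 : 0 ≤ (L₀ : ℝ)⁻¹ * ((n : ℝ) ^ (-(α / r)) / const3 d s M) ^ (-((d : ℝ) / (2 * s))) := by
    positivity
  refine max_le ?_ ?_
  · push_cast
    linarith
  · have := (Nat.ceil_lt_add_one h0).le
    linarith

/-- The width is `W₀ log₂ W₀` up to a constant; with `log w ≤ w^δ/δ` this is `O(W₀^(1+δ))`, and `δ`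
is chosen so that the exponent becomes `b`. -/
lemma powLE_widthSeq (hd : 1 ≤ d) (hs : 1 ≤ s) (hL : 2 ≤ L₀) (hr : 1 < r) (hα : 0 < α)
    (hM : 0 < M) {b : ℝ} (hb : α * d / (2 * r * s) < b) :
    PowLE (fun n => (widthSeq d s L₀ r α M n : ℝ)) b := by
  have hd' : (0 : ℝ) < d := by exact_mod_cast hd
  have hs' : (0 : ℝ) < s := by exact_mod_cast hs
  have hr0 : 0 < r := by linarith
  set β := α * d / (2 * r * s) with hβ_def
  have hβ : 0 < β := by positivity
  set δ := b / β - 1 with hδ_def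
  have hδ : 0 < δ := by
    rw [hδ_def, sub_pos, lt_div_iff₀ hβ]
    linarith
  have hexp : β * (1 + δ) = b := by
    rw [hδ_def]
    field_simp
    ring
  have h1 := (powLE_baseWidth (d := d) hs hL hr hα hM).rpow (fun n _ => Nat.cast_nonneg _)
    (by positivity : 0 ≤ 1 + δ)
  rw [← hβ_def, hexp] at h1
  have hb0 : 0 ≤ b := (hβ.trans hb).le
  have h2 := (PowLE.mul (PowLE.const (e := 0) (const1 d s / (δ * Real.log 2)) le_rfl) h1
    fun n _ => by positivity)
  rw [zero_add] at h2
  refine (h2.add (PowLE.const 1 hb0)).mono fun n hn => ?_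
  have hw : (0 : ℝ) < baseWidth d s L₀ r α M n := by
    exact_mod_cast zero_lt_two.trans_le (two_le_baseWidth d s L₀ r α M n)
  set w : ℝ := (baseWidth d s L₀ r α M n : ℝ) with hw_def
  have hc1 := zero_le_one.trans (one_le_const1 hd hs)
  have hlog2 : 0 < Real.log 2 := Real.log_pos one_lt_two
  have hlw : 0 ≤ Real.logb 2 w :=
    zero_le_one.trans (one_le_logb_two (two_le_baseWidth d s L₀ r α M n))
  have hceil := (Nat.ceil_lt_add_one (by positivity : 0 ≤ const1 d s * (w * Real.logb 2 w))).le
  refine hceil.trans (add_le_add ?_ le_rfl)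
  calc const1 d s * (w * Real.logb 2 w)
      ≤ const1 d s * (w * (w ^ δ / δ / Real.log 2)) := by
        rw [Real.logb]
        gcongr
        exact Real.log_le_rpow_div hw.le hδ
    _ = const1 d s / (δ * Real.log 2) * w ^ (1 + δ) := by
        rw [Real.rpow_add hw, Real.rpow_one]
        field_simp

lemma one_le_depthOf (hd : 1 ≤ d) : 1 ≤ depthOf d s L₀ := by
  unfold depthOf
  omega

/-- The bound `L (W² + W)` for the number of parameters. -/
lemma powLE_paramCount (hd : 1 ≤ d) (hs : 1 ≤ s) (hL : 2 ≤ L₀) (hr : 1 < r) (hα : 0 < α)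
    (hM : 0 < M) {b : ℝ} (hb : α * d / (2 * r * s) < b) :
    PowLE (fun n => (depthOf d s L₀ : ℝ)
      * ((widthSeq d s L₀ r α M n : ℝ) ^ 2 + widthSeq d s L₀ r α M n)) (2 * b) := by
  have hW := powLE_widthSeq hd hs hL hr hα hM hb
  have h2 := hW.rpow (fun n _ => Nat.cast_nonneg _) zero_le_two
  have h3 := PowLE.mul (PowLE.const (e := 0) (2 * (depthOf d s L₀ : ℝ)) le_rfl) h2
    fun n _ => by positivity
  rw [zero_add, mul_comm b 2] at h3
  refine h3.mono fun n hn => ?_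
  have h1 := one_le_widthSeq (L₀ := L₀) (r := r) (α := α) (M := M) hd hs n
  have hLn : (0 : ℝ) ≤ depthOf d s L₀ := Nat.cast_nonneg _
  rw [Real.rpow_two, mul_comm (2 : ℝ), mul_assoc]
  exact mul_le_mul_of_nonneg_left (by nlinarith) hLn

lemma one_le_paramCount (hd : 1 ≤ d) (hs : 1 ≤ s) (n : ℕ) :
    (1 : ℝ) ≤ (depthOf d s L₀ : ℝ)
      * ((widthSeq d s L₀ r α M n : ℝ) ^ 2 + widthSeq d s L₀ r α M n) := by
  have h1 := one_le_widthSeq (L₀ := L₀) (r := r) (α := α) (M := M) hd hs n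
  have h2 : (1 : ℝ) ≤ depthOf d s L₀ := by exact_mod_cast one_le_depthOf hd
  exact one_le_mul_of_one_le_of_one_le h2 (by nlinarith)

lemma le_boundSeq (hd : 1 ≤ d) (hs : 1 ≤ s) (hp : 0 < p) (hR : 0 < Rstar) (n : ℕ) :
    Rstar ≤ boundSeq d s L₀ p r α M Rstar n :=
  le_mul_of_one_le_right hR.le (Real.one_le_rpow (one_le_paramCount hd hs n) (by positivity))

lemma boundSeq_pos (hd : 1 ≤ d) (hs : 1 ≤ s) (hp : 0 < p) (hR : 0 < Rstar) (n : ℕ) :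
    0 < boundSeq d s L₀ p r α M Rstar n :=
  hR.trans_le (le_boundSeq hd hs hp hR n)

lemma powLE_boundSeq (hd : 1 ≤ d) (hs : 1 ≤ s) (hL : 2 ≤ L₀) (hp : 0 < p) (hr : 1 < r)
    (hα : 0 < α) (hM : 0 < M) {b : ℝ} (hb : α * d / (2 * r * s) < b) :
    PowLE (boundSeq d s L₀ p r α M Rstar) (2 * b / p) := by
  have h1 := (powLE_paramCount hd hs hL hr hα hM hb).rpow (fun n _ => by positivity)
    (by positivity : 0 ≤ 1 / p)
  have h2 := PowLE.mul (PowLE.const (e := 0) Rstar le_rfl) h1 fun n _ => by positivity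
  rw [zero_add, mul_one_div] at h2
  exact h2

lemma exists_le_boundSeq (hd : 1 ≤ d) (hs : 1 ≤ s) (hL : 2 ≤ L₀) (hp : 0 < p)
    (hM : 0 < M) (hR : 0 < Rstar) :
    ∃ c : ℝ, 0 < c ∧ ∀ n : ℕ, 1 ≤ n →
      c * (n : ℝ) ^ (α * d / (r * s * p)) ≤ boundSeq d s L₀ p r α M Rstar n := by
  obtain ⟨c, hc, hW⟩ := exists_le_widthSeq (r := r) (α := α) hd hs hL hM
  refine ⟨Rstar * (c ^ 2) ^ (1 / p), by positivity, fun n hn => ?_⟩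
  have hn' : (0 : ℝ) < n := by exact_mod_cast hn
  have h2 : (1 : ℝ) ≤ depthOf d s L₀ := by exact_mod_cast one_le_depthOf hd
  rw [boundSeq, mul_assoc]
  refine mul_le_mul_of_nonneg_left ?_ hR.le
  have e : (n : ℝ) ^ (α * d / (r * s * p)) = (((n : ℝ) ^ (α * d / (2 * r * s))) ^ 2) ^ (1 / p) := by
    rw [← Real.rpow_two, ← Real.rpow_mul hn'.le, ← Real.rpow_mul hn'.le]
    congr 1
    by_cases hr : r = 0
    · simp [hr]
    · have hs' : (s : ℝ) ≠ 0 := by positivity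
      field_simp
  rw [e, ← Real.mul_rpow (by positivity) (by positivity), ← mul_pow]
  refine Real.rpow_le_rpow (by positivity) ?_ (by positivity)
  have h3 := pow_le_pow_left₀ (by positivity) (hW n hn) 2
  have h4 : (0 : ℝ) ≤ widthSeq d s L₀ r α M n := Nat.cast_nonneg _
  calc _ ≤ (widthSeq d s L₀ r α M n : ℝ) ^ 2 + widthSeq d s L₀ r α M n := by linarith
    _ ≤ _ := le_mul_of_one_le_left (by positivity) h2

lemma eventually_one_le_boundSeq (hd : 1 ≤ d) (hs : 1 ≤ s) (hL : 2 ≤ L₀) (hp : 0 < p)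
    (hr : 1 < r) (hα : 0 < α) (hM : 0 < M) (hR : 0 < Rstar) :
    ∀ᶠ n : ℕ in atTop, 1 ≤ boundSeq d s L₀ p r α M Rstar n := by
  obtain ⟨c, hc, hB⟩ := exists_le_boundSeq (r := r) (α := α) hd hs hL hp hM hR
  have hd' : (0 : ℝ) < d := by exact_mod_cast hd
  have hs' : (0 : ℝ) < s := by exact_mod_cast hs
  have he : 0 < α * d / (r * s * p) := by positivity
  have h : Tendsto (fun n : ℕ => c * (n : ℝ) ^ (α * d / (r * s * p))) atTop atTop :=
    ((tendsto_rpow_atTop he).comp tendsto_natCast_atTop_atTop).const_mul_atTop hc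
  filter_upwards [h.eventually_ge_atTop 1, eventually_ge_atTop 1] with n h1 hn
  exact h1.trans (hB n hn)

/-- The true exponent is `αd/(rps)` up to logarithms. As `r > 1`, the asserted one leaves room for
them, and no logarithmic factor is needed. -/
lemma isSoftO_boundSeq (hd : 1 ≤ d) (hs : 1 ≤ s) (hL : 2 ≤ L₀) (hp : 0 < p)
    (hr : 1 < r) (hα : 0 < α) (hM : 0 < M) (hR : 0 < Rstar) :
    IsSoftO (boundSeq d s L₀ p r α M Rstar) (α * d / (p * s)) := by
  have hd' : (0 : ℝ) < d := by exact_mod_cast hd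
  have hs' : (0 : ℝ) < s := by exact_mod_cast hs
  have hb : α * d / (2 * r * s) < α * d / (2 * s) := by
    refine div_lt_div_of_pos_left (by positivity) (by positivity) ?_
    nlinarith
  have h := powLE_boundSeq (Rstar := Rstar) hd hs hL hp hr hα hM hb
  rw [show 2 * (α * d / (2 * s)) / p = α * d / (p * s) by field_simp] at h
  exact h.isSoftO fun n _ => (boundSeq_pos hd hs hp hR n).le

/-- `R_n` enters with a negative power, so its lower bound is the relevant one; that bound is free
of logarithms. -/
lemma isSoftO_lamMax (hd : 1 ≤ d) (hs : 1 ≤ s) (hL : 2 ≤ L₀) (hp : 0 < p)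
    (hr : 1 < r) (hM : 0 < M) (hR : 0 < Rstar) :
    IsSoftO (lamMax d s L₀ p r α M Rstar 1) (-(2 * α * (s + d) / (r * s))) := by
  obtain ⟨c, hc, hB⟩ := exists_le_boundSeq (r := r) (α := α) hd hs hL hp hM hR
  have hs' : (0 : ℝ) < s := by exact_mod_cast hs
  have hr0 : 0 < r := by linarith
  refine PowLE.isSoftO ⟨c ^ (-(2 * p)), by positivity, fun n hn => ?_⟩ fun n hn => ?_
  · have hn' : (0 : ℝ) < n := by exact_mod_cast hn
    have h1 : boundSeq d s L₀ p r α M Rstar n ^ (-(2 * p))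
        ≤ (c * (n : ℝ) ^ (α * d / (r * s * p))) ^ (-(2 * p)) :=
      Real.rpow_le_rpow_of_nonpos (by positivity) (hB n hn) (by linarith)
    rw [Real.mul_rpow hc.le (by positivity), ← Real.rpow_mul hn'.le] at h1
    calc lamMax d s L₀ p r α M Rstar 1 n
        ≤ (n : ℝ) ^ (-(2 * α / r))
          * (c ^ (-(2 * p)) * (n : ℝ) ^ (α * d / (r * s * p) * (-(2 * p)))) := by
          rw [lamMax, one_mul]
          gcongr
      _ = c ^ (-(2 * p)) * (n : ℝ) ^ (-(2 * α * (s + d) / (r * s))) := by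
          rw [mul_left_comm, ← Real.rpow_add hn']
          congr 2
          field_simp
          ring
  · have := boundSeq_pos (L₀ := L₀) (r := r) (α := α) (M := M) hd hs hp hR n
    rw [lamMax]
    positivity

/-- The base is a width of exponent `b` times a parameter bound of exponent `2b/p`. The growth is
polynomial because the depth does not vary with `n`. -/
lemma powLE_lipConst (hd : 1 ≤ d) (hs : 1 ≤ s) (hL : 2 ≤ L₀) (hp : 0 < p) (hr : 1 < r)
    (hα : 0 < α) (hM : 0 < M) (hR : 0 < Rstar) {b : ℝ} (hb : α * d / (2 * r * s) < b) :
    PowLE (fun n => lipConst (depthOf d s L₀) (widthSeq d s L₀ r α M n)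
      (boundSeq d s L₀ p r α M Rstar n)) (b * (1 + 2 / p) * depthOf d s L₀) := by
  have hb0 : 0 ≤ b := le_trans (by positivity) hb.le
  have h1 := (powLE_widthSeq hd hs hL hr hα hM hb).add (PowLE.const 1 hb0)
  have h2 := (powLE_boundSeq (Rstar := Rstar) hd hs hL hp hr hα hM hb).add (PowLE.const 1 (by positivity))
  have hB : ∀ n, 0 ≤ boundSeq d s L₀ p r α M Rstar n + 1 := fun n => by
    have := boundSeq_pos (L₀ := L₀) (r := r) (α := α) (M := M) hd hs hp hR n
    positivity
  have h3 := (h1.mul h2 fun n _ => hB n).rpow (fun n _ => mul_nonneg (by positivity) (hB n))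
    (Nat.cast_nonneg (depthOf d s L₀))
  have h4 := PowLE.mul (PowLE.const (e := 0) (depthOf d s L₀ : ℝ) le_rfl) h3
    fun n _ => Real.rpow_nonneg (mul_nonneg (by positivity) (hB n)) _
  rw [zero_add, show b + 2 * b / p = b * (1 + 2 / p) by ring] at h4
  refine h4.mono fun n hn => ?_
  rw [lipConst, Real.rpow_natCast]
  have := boundSeq_pos (L₀ := L₀) (r := r) (α := α) (M := M) hd hs hp hR n
  gcongr
  exact max_le (by linarith) (by linarith)

/-- The metric entropy of the network class, at a polynomially small scale. -/
lemma powLE_entropy (hd : 1 ≤ d) (hs : 1 ≤ s) (hL : 2 ≤ L₀) (hp : 0 < p) (hr : 1 < r)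
    (hα : 0 < α) (hM : 0 < M) (hR : 0 < Rstar) :
    PowLE (fun n => (depthOf d s L₀ : ℝ)
        * ((widthSeq d s L₀ r α M n : ℝ) ^ 2 + widthSeq d s L₀ r α M n)
      * Real.log (64 * boundSeq d s L₀ p r α M Rstar n
        * lipConst (depthOf d s L₀) (widthSeq d s L₀ r α M n) (boundSeq d s L₀ p r α M Rstar n)
        * ((2 * lipConst (depthOf d s L₀) (widthSeq d s L₀ r α M n)
            (boundSeq d s L₀ p r α M Rstar n)) ^ r * √(n : ℝ)) + 1)) (α * d / s) := by
  have hd' : (0 : ℝ) < d := by exact_mod_cast hd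
  have hs' : (0 : ℝ) < s := by exact_mod_cast hs
  have hr0 : 0 < r := by linarith
  -- Midway between `αd/(2rs)` and `αd/(2s)`: the parameter count takes `2b` and the logarithm takes
  -- the remainder `αd/(2s) · (1 - 1/r)`.
  set b := α * d / (4 * s) * (1 + 1 / r) with hb_def
  have hb : α * d / (2 * r * s) < b := by
    rw [hb_def, show α * d / (2 * r * s) = α * d / (4 * s) * (2 * (1 / r)) by
      field_simp; norm_num]
    refine mul_lt_mul_of_pos_left ?_ (by positivity)
    have : 1 / r < 1 := by rw [div_lt_one hr0]; exact hr
    linarith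
  have hb0 : 0 < b := by positivity
  have hδ : 0 < α * d / (2 * s) * (1 - 1 / r) := by
    have : 1 / r < 1 := by rw [div_lt_one hr0]; exact hr
    exact mul_pos (by positivity) (by linarith)
  have hB : ∀ n, 0 < boundSeq d s L₀ p r α M Rstar n := fun n => boundSeq_pos hd hs hp hR n
  have hΛ : ∀ n, 0 < lipConst (depthOf d s L₀) (widthSeq d s L₀ r α M n)
      (boundSeq d s L₀ p r α M Rstar n) := fun n =>
    zero_lt_one.trans_le (one_le_lipConst (one_le_depthOf hd) _)
  have l1 := powLE_lipConst hd hs hL hp hr hα hM hR hb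
  have l2 := (PowLE.const (e := 0) 64 le_rfl).mul (powLE_boundSeq (Rstar := Rstar) hd hs hL hp hr hα hM hb)
    fun n _ => (hB n).le
  have l3 := ((PowLE.const (e := 0) 2 le_rfl).mul l1 fun n _ => (hΛ n).le).rpow
    (fun n _ => by have := hΛ n; positivity) hr0.le
  have l4 : PowLE (fun n : ℕ => √(n : ℝ)) (1 / 2) :=
    ⟨1, one_pos, fun n _ => by simp only [one_mul, Real.sqrt_eq_rpow]; exact le_rfl⟩
  have l5 := (l2.mul l1 fun n _ => (hΛ n).le).mul (l3.mul l4 fun n _ => Real.sqrt_nonneg _)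
    fun n _ => by have := hΛ n; positivity
  have l6 := l5.add (PowLE.const 1 (by positivity))
  have l7 := l6.log (fun n _ => by
    have := hΛ n
    have := hB n
    rw [le_add_iff_nonneg_left]
    positivity) hδ
  have l8 := (powLE_paramCount hd hs hL hr hα hM hb).mul l7 fun n _ => Real.log_nonneg (by
    have := hΛ n
    have := hB n
    rw [le_add_iff_nonneg_left]
    positivity)
  rw [show 2 * b + α * d / (2 * s) * (1 - 1 / r) = α * d / s by
    rw [hb_def]; field_simp; ring] at l8
  exact l8

/-! ### The excess risk bound with a free margin -/

/-- The covering number is absorbed unless the bound is trivial. -/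
lemma covering_mul_tail_le {n P L : ℕ} (hn : 1 ≤ n) (hL : 1 ≤ L) {K m r Λ R G e y : ℝ}
    (hK : 0 < K) (hm : 0 < m) (hr : 0 < r) (hΛ : 0 < Λ) (hR : 0 ≤ R) (he : 0 ≤ e)
    (hlip : (2 * Λ) ^ (2 * r) ≤ (n : ℝ) ^ e) (hG : 1 ≤ G) (hy : 0 ≤ y)
    (hent : P * Real.log (64 * R * Λ * ((2 * Λ) ^ r * √(n : ℝ)) + 1) ≤ G * (n : ℝ) ^ y)
    (hnt : (n : ℝ) ^ y * G < K ^ 2 * (m ^ (2 * r) * (2 : ℝ) ^ (2 * r * (1 - (L : ℝ)))) / 288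
      * (n : ℝ) ^ (1 - e)) :
    (64 * R * Λ / (K * (m / (2 * Λ)) ^ r) + 1) ^ P
        * (2 * Real.exp (-(n * (K * (m / (2 * Λ)) ^ r) ^ 2 / 128))) ≤
      4 * Real.exp (-(K ^ 2 * (m ^ (2 * r) * (2 : ℝ) ^ (2 * r * (1 - (L : ℝ)))) / 288
        * (n : ℝ) ^ (1 - e)) + (n : ℝ) ^ y * G) := by
  have hn' : (0 : ℝ) < n := by exact_mod_cast hn
  have hn1 : (1 : ℝ) ≤ n := by exact_mod_cast hn
  have hL' : (1 : ℝ) ≤ L := by exact_mod_cast hL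
  have htwo : (2 : ℝ) ^ (2 * r * (1 - (L : ℝ))) ≤ 1 :=
    Real.rpow_le_one_of_one_le_of_nonpos one_le_two
      (mul_nonpos_of_nonneg_of_nonpos (by positivity) (by linarith))
  have hmr : 0 < m ^ r := Real.rpow_pos_of_pos hm r
  have hΛr : 0 < (2 * Λ) ^ r := Real.rpow_pos_of_pos (by positivity) r
  have hsq : ∀ {x : ℝ}, 0 < x → x ^ (2 * r) = (x ^ r) ^ 2 := fun {x} hx => by
    rw [mul_comm, Real.rpow_mul hx.le, Real.rpow_two]
  rw [hsq hm] at hnt ⊢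
  rw [hsq (by positivity : 0 < 2 * Λ)] at hlip
  set X := K ^ 2 * ((m ^ r) ^ 2 * (2 : ℝ) ^ (2 * r * (1 - (L : ℝ)))) / 288
    * (n : ℝ) ^ (1 - e) with hX_def
  have hXle : X ≤ K ^ 2 * (m ^ r) ^ 2 / 288 * (n : ℝ) ^ (1 - e) := by
    rw [hX_def]
    gcongr
    exact mul_le_of_le_one_right (by positivity) htwo
  have hdiv : (m / (2 * Λ)) ^ r = m ^ r / (2 * Λ) ^ r :=
    Real.div_rpow hm.le (by positivity) r
  -- Since `(2Λ)^(2r) ≤ n^e`, the Hoeffding exponent is at least `K² m^(2r) n^(1-e) / 128`; the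
  -- denominator `288` and the power of two in `X` only weaken this.
  have hXexp : X ≤ n * (K * (m / (2 * Λ)) ^ r) ^ 2 / 128 := by
    have h1 : K ^ 2 * (m ^ r) ^ 2 * (n : ℝ) ^ (1 - e) ≤ n * (K * (m / (2 * Λ)) ^ r) ^ 2 := by
      rw [Real.rpow_sub hn', Real.rpow_one, hdiv]
      calc K ^ 2 * (m ^ r) ^ 2 * (n / (n : ℝ) ^ e)
          ≤ K ^ 2 * (m ^ r) ^ 2 * (n / ((2 * Λ) ^ r) ^ 2) := by gcongr
        _ = n * (K * (m ^ r / (2 * Λ) ^ r)) ^ 2 := by field_simp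
    have h2 : 0 ≤ (n : ℝ) * (K * (m / (2 * Λ)) ^ r) ^ 2 := by positivity
    linarith
  -- Nontriviality gives `1 ≤ n^y G < X`, a lower bound for `K m^r` that frees the covering number
  -- from `K` and `m`.
  have hKm : 1 ≤ K * m ^ r * √(n : ℝ) := by
    have h1 : 1 ≤ (n : ℝ) ^ y * G :=
      one_le_mul_of_one_le_of_one_le (PowLE.one_le_cast_rpow hn hy) hG
    have h2 : (n : ℝ) ^ (1 - e) ≤ n := by
      conv_rhs => rw [← Real.rpow_one (n : ℝ)]
      exact Real.rpow_le_rpow_of_exponent_le hn1 (by linarith)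
    have h3 : 1 ≤ K ^ 2 * (m ^ r) ^ 2 * n := by
      have h4 : K ^ 2 * (m ^ r) ^ 2 * (n : ℝ) ^ (1 - e) ≤ K ^ 2 * (m ^ r) ^ 2 * n := by gcongr
      have h5 : 0 ≤ K ^ 2 * (m ^ r) ^ 2 * n := by positivity
      linarith
    refine (one_le_sq_iff₀ (by positivity)).1 ?_
    rw [mul_pow, mul_pow, Real.sq_sqrt hn'.le]
    exact h3
  have hbase : 64 * R * Λ / (K * (m / (2 * Λ)) ^ r) ≤ 64 * R * Λ * ((2 * Λ) ^ r * √(n : ℝ)) := by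
    rw [hdiv, div_le_iff₀ (by positivity)]
    have e1 : 64 * R * Λ * ((2 * Λ) ^ r * √(n : ℝ)) * (K * (m ^ r / (2 * Λ) ^ r))
        = 64 * R * Λ * (K * m ^ r * √(n : ℝ)) := by
      field_simp
    rw [e1]
    exact le_mul_of_one_le_right (by positivity) hKm
  have hcov : (64 * R * Λ / (K * (m / (2 * Λ)) ^ r) + 1) ^ P ≤ Real.exp ((n : ℝ) ^ y * G) := by
    refine (pow_le_pow_left₀ (by positivity) (add_le_add hbase le_rfl) P).trans ?_
    rw [← Real.rpow_natCast, Real.rpow_def_of_pos (by positivity), mul_comm _ (P : ℝ),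
      mul_comm _ G]
    exact Real.exp_le_exp.2 hent
  calc _ ≤ Real.exp ((n : ℝ) ^ y * G) * (2 * Real.exp (-X)) := by
        refine mul_le_mul hcov ?_ (by positivity) (by positivity)
        exact mul_le_mul_of_nonneg_left (Real.exp_le_exp.2 (neg_le_neg hXexp)) zero_le_two
    _ = 2 * Real.exp (-X + (n : ℝ) ^ y * G) := by rw [Real.exp_add]; ring
    _ ≤ _ := mul_le_mul_of_nonneg_right (by norm_num) (Real.exp_pos _).le

/-- The regularization term of a parametrization bounded by `Rstar` is negligible. -/
lemma regularization_le (hd : 1 ≤ d) (hs : 1 ≤ s) (hp : 0 < p) (hR : 0 < Rstar) {n : ℕ}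
    (hn : 1 ≤ n) (hB : 1 ≤ boundSeq d s L₀ p r α M Rstar n) (a : Arch d)
    (hw : a.width = widthSeq d s L₀ r α M n) (hdep : a.depth = depthOf d s L₀) {lam : ℝ}
    (hlam : 0 ≤ lam) (hlam' : lam ≤ lamMax d s L₀ p r α M Rstar 1 n) {θ : Params a}
    (hθ : ‖θ‖ ≤ Rstar) :
    lam / 2 * penalty a p θ ≤ ((n : ℝ) ^ (-(α / r))) ^ 2 / 2 := by
  set B := boundSeq d s L₀ p r α M Rstar n with hB_def
  have hn' : (0 : ℝ) < n := by exact_mod_cast hn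
  have hB0 : 0 < B := zero_lt_one.trans_le hB
  have hP := one_le_paramCount (L₀ := L₀) (r := r) (α := α) (M := M) hd hs n
  -- `R_n` is defined so that the parameter count times `Rstar^p` equals `R_n^p`.
  have hpen : penalty a p θ ≤ B ^ p := by
    have h := penalty_le a hp hθ
    rw [hw, hdep] at h
    refine h.trans (le_of_eq ?_)
    rw [hB_def, boundSeq, Real.mul_rpow hR.le (Real.rpow_nonneg (zero_le_one.trans hP) _),
      ← Real.rpow_mul (zero_le_one.trans hP), one_div, inv_mul_cancel₀ hp.ne', Real.rpow_one,
      mul_comm]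
  have hexp : ((n : ℝ) ^ (-(α / r))) ^ 2 = (n : ℝ) ^ (-(2 * α / r)) := by
    rw [← Real.rpow_two, ← Real.rpow_mul hn'.le]
    ring_nf
  -- The product is `n^(-2α/r) R_n^(-p)`, and `R_n ≥ 1` discards the last factor.
  have hlm : lamMax d s L₀ p r α M Rstar 1 n * B ^ p ≤ (n : ℝ) ^ (-(2 * α / r)) := by
    rw [lamMax, one_mul, ← hB_def, mul_assoc, ← Real.rpow_add hB0]
    refine mul_le_of_le_one_right (by positivity)
      (Real.rpow_le_one_of_one_le_of_nonpos hB (by linarith))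
  have h1 : lam * penalty a p θ ≤ lamMax d s L₀ p r α M Rstar 1 n * B ^ p :=
    mul_le_mul hlam' hpen (penalty_nonneg a p θ) (hlam.trans hlam')
  rw [hexp]
  linarith

/-- The common core of both noise regimes, with constants chosen before the law, the sample, `K` and
the margin `m`. The second bound, for `n < N`, is the trivial one; it serves the hard-margin case
when `n` is small compared with `δ`. -/
lemma exists_excess_risk_constants (hd : 1 ≤ d) (hs : 1 ≤ s) (hL : 2 ≤ L₀) (hp : 0 < p)
    (hr : 1 < r) (hα : 0 < α) (hM : 0 < M) (hR : 0 < Rstar) {A : ℝ}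
    (hA : 2 * d * (1 + 2 / p) * depthOf d s L₀ / s < A) :
    ∃ (G : ℝ) (T : ℕ → ℝ), 0 ≤ G ∧ (∀ N, 0 ≤ T N) ∧
      ∀ {Ω : Type*} [MeasurableSpace Ω] (μ : Measure Ω) [IsProbabilityMeasure μ]
        (ρ : Measure ((Fin d → ℝ) × ℝ)) [IsProbabilityMeasure ρ]
        (Z : ℕ → Ω → (Fin d → ℝ) × ℝ) (η : (Fin d → ℝ) → ℝ),
        IsBinaryLaw ρ → IsIIDSample μ ρ Z → IsRegressionFunction ρ η →
        ∀ n : ℕ, 1 ≤ n → ∀ a : Arch d,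
          a.width = widthSeq d s L₀ r α M n → a.depth = depthOf d s L₀ →
          Approximates a η ((n : ℝ) ^ (-(α / r))) → BoundedMinimizers μ ρ Z a Rstar →
          ∀ lam K : ℝ, 0 ≤ lam → lam ≤ lamMax d s L₀ p r α M Rstar 1 n → 0 < K →
          WellSeparated ρ a p (boundSeq d s L₀ p r α M Rstar n) lam K r →
          ∀ θhat : Ω → Params a,
            (∀ᵐ ω ∂μ, θhat ω ∈ minNormERM (fun i => Z i ω) n a p lam
              (boundSeq d s L₀ p r α M Rstar n)) →
            ∀ m : ℝ, 0 < m → m ≤ 1 →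
              ((∫ ω, misRisk ρ (net a (θhat ω)) ∂μ) - misRisk ρ η ≤
                ρ.real {z | |η z.1| ≤ m} + 6 * ((n : ℝ) ^ (-(α / r))) ^ 2 / m ^ 2
                + 4 * Real.exp (-(K ^ 2 * (m ^ (2 * r)
                    * (2 : ℝ) ^ (2 * r * (1 - (depthOf d s L₀ : ℝ)))) / 288
                  * (n : ℝ) ^ (1 - α * A)) + (n : ℝ) ^ (α * d / s) * G)) ∧
              ∀ N : ℕ, n < N →
                (∫ ω, misRisk ρ (net a (θhat ω)) ∂μ) - misRisk ρ η ≤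
                4 * Real.exp (-(K ^ 2 * (m ^ (2 * r)
                    * (2 : ℝ) ^ (2 * r * (1 - (depthOf d s L₀ : ℝ)))) / 288
                  * (n : ℝ) ^ (1 - α * A)) + (n : ℝ) ^ (α * d / s) * T N) := by
  have hd' : (0 : ℝ) < d := by exact_mod_cast hd
  have hs' : (0 : ℝ) < s := by exact_mod_cast hs
  have hr0 : 0 < r := by linarith
  have hdep1 : 1 ≤ depthOf d s L₀ := one_le_depthOf hd
  have hdep1' : (1 : ℝ) ≤ depthOf d s L₀ := by exact_mod_cast hdep1
  have hA0 : 0 < A := lt_of_le_of_lt (by positivity) hA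
  have hy : 0 ≤ α * d / s := by positivity
  have hB : ∀ n, 0 < boundSeq d s L₀ p r α M Rstar n := fun n => boundSeq_pos hd hs hp hR n
  have hΛ : ∀ n, 0 < lipConst (depthOf d s L₀) (widthSeq d s L₀ r α M n)
      (boundSeq d s L₀ p r α M Rstar n) := fun n =>
    zero_lt_one.trans_le (one_le_lipConst hdep1 _)
  have hb : α * d / (2 * r * s) < α * d / (r * s) := by
    refine div_lt_div_of_pos_left (by positivity) (by positivity) ?_
    nlinarith [mul_pos hr0 hs']
  -- With `b = αd/(rs)` the power `2r` cancels `r`, so the condition on `A` involves neither `r` nor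
  -- `α`.
  have hlip := (((PowLE.const (e := 0) 2 le_rfl).mul
    (powLE_lipConst hd hs hL hp hr hα hM hR hb) fun n _ => (hΛ n).le).rpow
    (fun n _ => by have := hΛ n; positivity) (by positivity : 0 ≤ 2 * r)).eventually_le
    (f := α * A) (by
      rw [zero_add, show α * d / (r * s) * (1 + 2 / p) * depthOf d s L₀ * (2 * r)
        = α * (2 * d * (1 + 2 / p) * depthOf d s L₀ / s) by field_simp]
      exact mul_lt_mul_of_pos_left hA hα)
  obtain ⟨n₀, hn₀⟩ := eventually_atTop.1
    (hlip.and (eventually_one_le_boundSeq (L₀ := L₀) hd hs hL hp hr hα hM hR))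
  obtain ⟨c, hc, hent⟩ := powLE_entropy hd hs hL hp hr hα hM hR
  choose Kmax hKmax using fun n => exists_forall_wellSeparated_const_le d (depthOf d s L₀)
    (widthSeq d s L₀ r α M n) hdep1 hp (hB n) (lamMax d s L₀ p r α M Rstar 1 n) r
  set T : ℕ → ℝ := fun N => ∑ n ∈ Finset.range N, Kmax n ^ 2 * (n : ℝ) ^ (1 - α * A) with hT_def
  have hT : ∀ N, 0 ≤ T N := fun N => Finset.sum_nonneg fun n _ => by positivity
  -- `c` pays for the entropy, `1` ensures that the constant is at least one, and `T n₀` makes the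
  -- bound trivial for `n < n₀`.
  refine ⟨c + 1 + T n₀, T, by have := hT n₀; positivity, hT, ?_⟩
  intro Ω _ μ _ ρ _ Z η hρ hZ hη n hn a hw hdep happ hbd lam K hlam hlam' hK hsep θhat hhat m hm hm1
  have hone : (∫ ω, misRisk ρ (net a (θhat ω)) ∂μ) - misRisk ρ η ≤ 1 := by
    have h1 : ∫ ω, misRisk ρ (net a (θhat ω)) ∂μ ≤ 1 :=
      (integral_mono_of_nonneg (ae_of_all _ fun ω => misRisk_nonneg _)
        (integrable_const (1 : ℝ)) (ae_of_all _ fun ω => misRisk_le_one _)).trans (by simp)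
    have := misRisk_nonneg (ρ := ρ) η
    linarith
  have htriv : ∀ {v : ℝ}, 0 ≤ v →
      (∫ ω, misRisk ρ (net a (θhat ω)) ∂μ) - misRisk ρ η ≤ 4 * Real.exp v := fun {v} hv => by
    have := Real.one_le_exp hv
    linarith
  have hny := PowLE.one_le_cast_rpow hn hy
  set X := K ^ 2 * (m ^ (2 * r) * (2 : ℝ) ^ (2 * r * (1 - (depthOf d s L₀ : ℝ)))) / 288
    * (n : ℝ) ^ (1 - α * A) with hX_def
  have hsmall : ∀ N : ℕ, n < N → X ≤ (n : ℝ) ^ (α * d / s) * T N := by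
    intro N hN
    have hKK : K ≤ Kmax n := hKmax n a ρ lam K hdep hw hρ hlam hlam' hsep
    have h1 : m ^ (2 * r) ≤ 1 := Real.rpow_le_one hm.le hm1 (by positivity)
    have h2 : (2 : ℝ) ^ (2 * r * (1 - (depthOf d s L₀ : ℝ))) ≤ 1 :=
      Real.rpow_le_one_of_one_le_of_nonpos one_le_two
        (mul_nonpos_of_nonneg_of_nonpos (by positivity) (by linarith))
    have h3 : m ^ (2 * r) * (2 : ℝ) ^ (2 * r * (1 - (depthOf d s L₀ : ℝ))) ≤ 1 :=
      mul_le_one₀ h1 (by positivity) h2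
    have h4 : X ≤ Kmax n ^ 2 * (n : ℝ) ^ (1 - α * A) := by
      rw [hX_def]
      refine mul_le_mul_of_nonneg_right ?_ (by positivity)
      have h5 : K ^ 2 ≤ Kmax n ^ 2 := pow_le_pow_left₀ hK.le hKK 2
      have h6 := mul_le_of_le_one_right (sq_nonneg K) h3
      have h7 : 0 ≤ K ^ 2 * (m ^ (2 * r) * (2 : ℝ) ^ (2 * r * (1 - (depthOf d s L₀ : ℝ)))) := by
        positivity
      linarith
    have h5 : Kmax n ^ 2 * (n : ℝ) ^ (1 - α * A) ≤ T N :=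
      Finset.single_le_sum (f := fun n : ℕ => Kmax n ^ 2 * (n : ℝ) ^ (1 - α * A))
        (fun i _ => by positivity) (Finset.mem_range.2 hN)
    exact (h4.trans h5).trans (le_mul_of_one_le_left (hT N) hny)
  refine ⟨?_, fun N hN => htriv (by linarith [hsmall N hN])⟩
  have hβ : 0 ≤ ρ.real {z | |η z.1| ≤ m} + 6 * ((n : ℝ) ^ (-(α / r))) ^ 2 / m ^ 2 := by
    positivity
  by_cases hXG : X ≤ (n : ℝ) ^ (α * d / s) * (c + 1 + T n₀)
  · exact (htriv (by linarith)).trans (le_add_of_nonneg_left hβ)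
  have hn₀n : n₀ ≤ n := by
    by_contra hcon
    refine hXG ((hsmall n₀ (not_le.1 hcon)).trans ?_)
    exact mul_le_mul_of_nonneg_left (by linarith) (by positivity)
  obtain ⟨hlipn, hB1⟩ := hn₀ n hn₀n
  obtain ⟨θa, hθa⟩ := happ
  obtain ⟨θs, hθs, hsa⟩ := exists_norm_le_forall_sqRisk_le hρ hZ a hR.le hbd θa
  have hpen := regularization_le hd hs hp hR hn hB1 a hw hdep hlam hlam' hθs
  have hmain := integral_misRisk_sub_le hρ hZ hη a hp (hB n).le hlam hK hm hθa
    (hθs.trans (le_boundSeq hd hs hp hR n)) hsa hpen hsep hn hhat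
    (Λ := lipConst (depthOf d s L₀) (widthSeq d s L₀ r α M n)
      (boundSeq d s L₀ p r α M Rstar n)) (by rw [hw, hdep])
  refine hmain.trans (add_le_add le_rfl ?_)
  have hcast : ((a.depth * (a.width ^ 2 + a.width) : ℕ) : ℝ) = (depthOf d s L₀ : ℝ)
      * ((widthSeq d s L₀ r α M n : ℝ) ^ 2 + widthSeq d s L₀ r α M n) := by
    rw [hw, hdep]
    push_cast
    ring
  refine covering_mul_tail_le hn hdep1 hK hm hr0 (hΛ n) (hB n).le (by positivity) hlipn
    (by linarith [hT n₀]) hy ?_ (not_le.1 hXG)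
  rw [hcast]
  refine (hent n hn).trans ?_
  exact mul_le_mul_of_nonneg_right (by linarith [hT n₀]) (by positivity)

/-- Architectures of the prescribed size approximate the regression function. -/
lemma RegularRegression.exists_approximates {η : (Fin d → ℝ) → ℝ} (hd : 1 ≤ d) (hs : 1 ≤ s)
    (hL : 2 ≤ L₀) (hM : 0 < M) (hreg : RegularRegression s η) (hnorm : csNorm s η = M) {n : ℕ}
    (hn : 1 ≤ n) :
    ∃ a : Arch d, a.width = widthSeq d s L₀ r α M n ∧ a.depth = depthOf d s L₀ ∧
      Approximates a η ((n : ℝ) ^ (-(α / r))) := by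
  obtain ⟨a, hw, hdep, θ, hθ⟩ := hreg.2 _ L₀ (two_le_baseWidth d s L₀ r α M n) hL
  refine ⟨a, hw, hdep, θ, fun x hx => (hθ x hx).trans ?_⟩
  have hd' : (0 : ℝ) < d := by exact_mod_cast hd
  have hs' : (0 : ℝ) < s := by exact_mod_cast hs
  have hn' : (0 : ℝ) < n := by exact_mod_cast hn
  have hL' : (0 : ℝ) < L₀ := by exact_mod_cast (by omega : 0 < L₀)
  have hC := const3_pos (d := d) hs hM
  rw [hnorm]
  set w := baseWidth d s L₀ r α M n with hw_def
  set q := (n : ℝ) ^ (-(α / r)) / const3 d s M with hq_def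
  have hq : 0 < q := by positivity
  have h1 : (L₀ : ℝ)⁻¹ * q ^ (-((d : ℝ) / (2 * s))) ≤ w :=
    (Nat.le_ceil _).trans (Nat.cast_le.2 (le_max_right _ _))
  rw [inv_mul_le_iff₀ hL'] at h1
  have h2 : ((L₀ : ℝ) * w) ^ (-(2 * (s : ℝ) / d)) ≤ q := by
    refine (Real.rpow_le_rpow_of_nonpos (by positivity) h1
      (neg_nonpos.2 (by positivity))).trans (le_of_eq ?_)
    rw [← Real.rpow_mul hq.le, neg_mul_neg,
      show (d : ℝ) / (2 * s) * (2 * s / d) = 1 by field_simp, Real.rpow_one]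
  rw [Real.mul_rpow hL'.le (Nat.cast_nonneg _)] at h2
  calc const3 d s M * (w : ℝ) ^ (-(2 * (s : ℝ) / d)) * (L₀ : ℝ) ^ (-(2 * (s : ℝ) / d))
      = const3 d s M * ((L₀ : ℝ) ^ (-(2 * (s : ℝ) / d)) * (w : ℝ) ^ (-(2 * (s : ℝ) / d))) := by
        ring
    _ ≤ const3 d s M * q := mul_le_mul_of_nonneg_left h2 hC.le
    _ = (n : ℝ) ^ (-(α / r)) := by
        rw [hq_def]
        field_simp

/-- The depth is at most `√s L₀ log₂ L₀ + 2d + 1`. -/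
lemma depthOf_div_lt {s L₀ : ℕ} (hs : 1 ≤ s) (hL : 2 ≤ L₀) {c : ℝ} (hc : 0 ≤ c) :
    c * depthOf d s L₀ / s <
      c * (L₀ * Real.logb 2 L₀) / √(s : ℝ) + (c * (2 * d + 1) + 1) / s := by
  have hs' : (0 : ℝ) < s := by exact_mod_cast hs
  have hl := one_le_logb_two hL
  have h1 : (depthOf d s L₀ : ℝ) ≤ √(s : ℝ) * (L₀ * Real.logb 2 L₀) + (2 * d + 1) := by
    have := (Nat.ceil_lt_add_one (by positivity : 0 ≤ √(s : ℝ) * (L₀ * Real.logb 2 L₀))).le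
    unfold depthOf
    push_cast
    linarith
  have hsq : √(s : ℝ) / s = 1 / √(s : ℝ) := by
    rw [Real.sqrt_div_self]
    ring
  calc c * depthOf d s L₀ / s
      ≤ c * (√(s : ℝ) * (L₀ * Real.logb 2 L₀) + (2 * d + 1)) / s := by gcongr
    _ = c * (L₀ * Real.logb 2 L₀) * (√(s : ℝ) / s) + c * (2 * d + 1) / s := by ring
    _ < c * (L₀ * Real.logb 2 L₀) * (√(s : ℝ) / s) + (c * (2 * d + 1) + 1) / s := by
        gcongr
        linarith
    _ = _ := by rw [hsq]; ring

/-- The margin in the hard-margin condition is less than one. -/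
lemma HardMargin.lt_one {ρ : Measure ((Fin d → ℝ) × ℝ)} [IsProbabilityMeasure ρ]
    {η : (Fin d → ℝ) → ℝ} {δ : ℝ} (h : HardMargin ρ η δ) (hρ : IsBinaryLaw ρ)
    (hη : IsRegressionFunction ρ η) : δ < 1 := by
  obtain ⟨z, h1, h2⟩ := (Filter.Eventually.and h (ae_abs_regression_le hρ hη)).exists
  exact h1.trans_le h2

lemma HardMargin.measureReal_eq_zero {ρ : Measure ((Fin d → ℝ) × ℝ)}
    {η : (Fin d → ℝ) → ℝ} {δ : ℝ} (h : HardMargin ρ η δ) : ρ.real {z | |η z.1| ≤ δ} = 0 := by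
  have h0 : ρ {z | ¬ δ < |η z.1|} = 0 := ae_iff.1 h
  simp only [not_lt] at h0
  rw [measureReal_def, h0, ENNReal.toReal_zero]

/-- Enlarging the exponent of the error term. -/
lemma exp_exponent_le {n : ℕ} (hn : 1 ≤ n) {X X' G g u y : ℝ} (hX : X' ≤ X) (hg : 0 < g)
    (hG : G ≤ Real.log g) (hu : 1 ≤ u) :
    4 * Real.exp (-X + (n : ℝ) ^ y * G)
      ≤ 4 * Real.exp (-X' + (n : ℝ) ^ y * Real.log (g * u)) := by
  have h1 : Real.log g ≤ Real.log (g * u) :=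
    Real.log_le_log hg (le_mul_of_one_le_right hg.le hu)
  have h2 : (n : ℝ) ^ y * G ≤ (n : ℝ) ^ y * Real.log (g * u) :=
    mul_le_mul_of_nonneg_left (hG.trans h1) (by positivity)
  exact mul_le_mul_of_nonneg_left (Real.exp_le_exp.2 (by linarith)) (by norm_num)

end DeepClassifier

/-! ### Choice of the constants and the two noise regimes. -/

open DeepClassifier in
theorem theorem2 (p : ℝ) (hp : 0 < p) :
    ∃ lamBar : ℝ, 0 < lamBar ∧
    ∀ d L₀ : ℕ, 1 ≤ d → 2 ≤ L₀ →
    -- `B₁, B₂` for the low-noise case, `B₁', B₂'` for the hard-margin case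
    ∃ B₁ B₂ B₁' B₂' : ℝ, 0 < B₁ ∧ (d : ℝ) < B₂ ∧ 0 < B₁' ∧ (d : ℝ) < B₂' ∧
    ∀ (s : ℕ) (r : ℝ), 1 ≤ s → 1 < r →
    ∃ κ κ' : ℝ, 0 < κ ∧ 0 < κ' ∧
    ∀ α Rstar M : ℝ, 0 < α → 0 < Rstar → 0 < M →
      -- growth of the parameter bound and of the admissible regularization
      IsSoftO (boundSeq d s L₀ p r α M Rstar) (α * d / (p * s)) ∧
      IsSoftO (lamMax d s L₀ p r α M Rstar lamBar) (-(2 * α * (s + d) / (r * s))) ∧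
      -- the linear-in-`n` exponent dominates
      (α < (1 + B₁ / √(s : ℝ) + B₂ / s)⁻¹ →
        α * d / s < 1 - α * (1 + B₁ / √(s : ℝ) + (B₂ - d) / s)) ∧
      (α < s * √(s : ℝ) / (s * B₁' + √(s : ℝ) * B₂') →
        α * d / s < 1 - α * (B₁' / √(s : ℝ) + (B₂' - d) / s)) ∧
      ∃ γ γ' : ℝ, ∃ Γ : ℝ → ℝ, 0 < γ ∧ 0 < γ' ∧ (∀ δ, 0 < Γ δ) ∧
      ∀ {Ω : Type*} [MeasurableSpace Ω] (μ : Measure Ω) [IsProbabilityMeasure μ]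
        (ρ : Measure ((Fin d → ℝ) × ℝ)) [IsProbabilityMeasure ρ]
        (Z : ℕ → Ω → (Fin d → ℝ) × ℝ) (η : (Fin d → ℝ) → ℝ),
        IsBinaryLaw ρ → IsIIDSample μ ρ Z → IsRegressionFunction ρ η →
        RegularRegression s η → csNorm s η = M →
        ∀ n : ℕ, 1 ≤ n →
          -- a suitable architecture exists
          (∃ a : Arch d, a.width = widthSeq d s L₀ r α M n ∧ a.depth = depthOf d s L₀ ∧
            Approximates a η ((n : ℝ) ^ (-(α / r)))) ∧
          -- and every such architecture satisfies the excess risk bounds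
          ∀ a : Arch d, a.width = widthSeq d s L₀ r α M n → a.depth = depthOf d s L₀ →
            Approximates a η ((n : ℝ) ^ (-(α / r))) →
            BoundedMinimizers μ ρ Z a Rstar →
            ∀ lam K : ℝ, 0 ≤ lam → lam ≤ lamMax d s L₀ p r α M Rstar lamBar n → 0 < K →
            WellSeparated ρ a p (boundSeq d s L₀ p r α M Rstar n) lam K r →
            ∀ θhat : Ω → Params a,
              (∀ᵐ ω ∂μ, θhat ω ∈ minNormERM (fun i => Z i ω) n a p lam
                (boundSeq d s L₀ p r α M Rstar n)) →
              AEMeasurable (fun ω => misRisk ρ (net a (θhat ω))) μ →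
              -- low noise
              (∀ q C : ℝ, 0 < q → 0 < C → LowNoise ρ η q C →
                α < (1 + B₁ / √(s : ℝ) + B₂ / s)⁻¹ →
                (∫ ω, misRisk ρ (net a (θhat ω)) ∂μ) - misRisk ρ η
                  ≤ 6 * (n : ℝ) ^ (-(α / r)) + C * (n : ℝ) ^ (-(α * q / (2 * r)))
                    + 4 * Real.exp
                      (-(K ^ 2 * (2 : ℝ) ^ (2 * r * (1 - (depthOf d s L₀ : ℝ))) / 288)
                          * (n : ℝ) ^ (1 - α * (1 + B₁ / √(s : ℝ) + (B₂ - d) / s))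
                        + (n : ℝ) ^ (α * d / s) * Real.log (γ * (n : ℝ) ^ (α * κ)))) ∧
              -- hard margin: `Γ δ` works for all `n`, and `γ'`, free of `δ`, once `n^(-α/r) ≤ δ²`
              (∀ δ : ℝ, 0 < δ → HardMargin ρ η δ →
                α < s * √(s : ℝ) / (s * B₁' + √(s : ℝ) * B₂') →
                ∀ g : ℝ, (g = Γ δ ∨ (g = γ' ∧ (n : ℝ) ^ (-(α / r)) ≤ δ ^ 2)) →
                (∫ ω, misRisk ρ (net a (θhat ω)) ∂μ) - misRisk ρ η
                  ≤ 18 * (n : ℝ) ^ (-(α / r))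
                    + 4 * Real.exp
                      (-(K ^ 2 * (δ * (2 : ℝ) ^ (-(depthOf d s L₀ : ℝ))) ^ (2 * r) / 288)
                          * (n : ℝ) ^ (1 - α * (B₁' / √(s : ℝ) + (B₂' - d) / s))
                        + (n : ℝ) ^ (α * d / s)
                          * Real.log (g * (n : ℝ) ^ (α * κ') * (δ / 2) ^ (-r)))) := by
  refine ⟨1, one_pos, fun d L₀ hd hL => ?_⟩
  have hd' : (0 : ℝ) < d := by exact_mod_cast hd
  have hl := one_le_logb_two hL
  have hL' : (0 : ℝ) < L₀ := by exact_mod_cast (by omega : 0 < L₀)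
  set c : ℝ := 2 * d * (1 + 2 / p) with hc_def
  have hc : 0 < c := by positivity
  set B₁ : ℝ := c * (L₀ * Real.logb 2 L₀) with hB₁_def
  -- `B₂ - d` comes from the additive part `2d + 1` of the depth bound, with `+ 1` for strictness.
  -- The added `d` reserves the exponent `αd/s` of the entropy.
  set B₂ : ℝ := d + (c * (2 * d + 1) + 1) with hB₂_def
  have hB₁ : 0 < B₁ := by positivity
  have hB₂ : (d : ℝ) < B₂ := lt_add_of_pos_right _ (by positivity)
  -- Any positive `κ`, `κ'` do: the entropy logarithm is already absorbed, so the powers of `n` in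
  -- the logarithm, being at least one, only enlarge the bound.
  refine ⟨B₁, B₂, B₁, B₂, hB₁, hB₂, hB₁, hB₂, fun s r hs hr => ⟨1, 1, one_pos, one_pos, ?_⟩⟩
  intro α Rstar M hα hR hM
  have hs' : (0 : ℝ) < s := by exact_mod_cast hs
  have hr0 : 0 < r := by linarith
  set A : ℝ := B₁ / √(s : ℝ) + (B₂ - d) / s with hA_def
  have hA : c * depthOf d s L₀ / s < A := by
    rw [hA_def, hB₁_def, hB₂_def, add_sub_cancel_left]
    exact depthOf_div_lt hs hL hc.le
  have hAd : A = B₁ / √(s : ℝ) + B₂ / s - d / s := by rw [hA_def]; ring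
  refine ⟨isSoftO_boundSeq hd hs hL hp hr hα hM hR, isSoftO_lamMax hd hs hL hp hr hM hR, ?_, ?_,
    ?_⟩
  · intro h
    have hpos : 0 < 1 + B₁ / √(s : ℝ) + B₂ / s := by
      have := hd'.trans hB₂
      positivity
    rw [lt_inv_comm₀ hα hpos, ← one_div, lt_div_iff₀ hα] at h
    have e : α * (1 + B₁ / √(s : ℝ) + (B₂ - d) / s)
        = (1 + B₁ / √(s : ℝ) + B₂ / s) * α - α * d / s := by ring
    linarith
  · intro h
    have hpos : 0 < s * B₁ + √(s : ℝ) * B₂ := by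
      have := hd'.trans hB₂
      positivity
    rw [lt_div_iff₀ hpos] at h
    have hsq : √(s : ℝ) * √(s : ℝ) = s := Real.mul_self_sqrt hs'.le
    have hss : 0 < s * √(s : ℝ) := by positivity
    have e : α * (B₁ / √(s : ℝ) + B₂ / s) = α * (s * B₁ + √(s : ℝ) * B₂) / (s * √(s : ℝ)) := by
      field_simp
    have h2 : α * (B₁ / √(s : ℝ) + B₂ / s) < 1 := by
      rw [e, div_lt_one hss]
      exact h
    have e2 : α * A = α * (B₁ / √(s : ℝ) + B₂ / s) - α * d / s := by
      rw [hAd]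
      ring
    rw [e2]
    linarith
  obtain ⟨G, T, hG, hT, hcore⟩ := exists_excess_risk_constants hd hs hL hp hr hα hM hR hA
  -- `N δ` is a threshold beyond which `ε ≤ δ²`; only `Γ δ` has to cover the smaller `n`.
  have hN : ∀ δ : ℝ, ∃ N : ℕ, 0 < δ → ∀ n : ℕ, N ≤ n → (n : ℝ) ^ (-(α / r)) ≤ δ ^ 2 := by
    intro δ
    by_cases hδ : 0 < δ
    · have h : Tendsto (fun n : ℕ => (n : ℝ) ^ (-(α / r))) atTop (nhds 0) :=
        (tendsto_rpow_neg_atTop (by positivity)).comp tendsto_natCast_atTop_atTop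
      obtain ⟨N, hN⟩ := eventually_atTop.1 (h.eventually (ge_mem_nhds (by positivity : 0 < δ ^ 2)))
      exact ⟨N, fun _ => hN⟩
    · exact ⟨0, fun h => absurd h hδ⟩
  choose N hN using hN
  refine ⟨Real.exp G, Real.exp G, fun δ => Real.exp (G + T (N δ)), Real.exp_pos _, Real.exp_pos _,
    fun δ => Real.exp_pos _, ?_⟩
  intro Ω _ μ _ ρ _ Z η hρ hZ hη hreg hnorm n hn
  refine ⟨hreg.exists_approximates hd hs hL hM hnorm hn, ?_⟩
  intro a hw hdep happ hbd lam K hlam hlam' hK hsep θhat hhat _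
  have hcore' := hcore μ ρ Z η hρ hZ hη n hn a hw hdep happ hbd lam K hlam hlam' hK hsep θhat hhat
  have hn' : (0 : ℝ) < n := by exact_mod_cast hn
  have hn1 : (1 : ℝ) ≤ n := by exact_mod_cast hn
  have hnα : 1 ≤ (n : ℝ) ^ (α * 1) := PowLE.one_le_cast_rpow hn (by positivity)
  set ε := (n : ℝ) ^ (-(α / r)) with hε_def
  have hε : 0 < ε := by positivity
  constructor
  · intro q C hq hC hlow _
    -- With `m² = ε` the Chebyshev term is `6ε`. The price is `m^(2r) = n^(-α)`, the summand `1` in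
    -- `A₂`.
    set m := (n : ℝ) ^ (-(α / (2 * r))) with hm_def
    have hm : 0 < m := by positivity
    have hm1 : m ≤ 1 :=
      Real.rpow_le_one_of_one_le_of_nonpos hn1 (neg_nonpos.2 (by positivity))
    have hm2 : m ^ 2 = ε := by
      rw [hm_def, hε_def, ← Real.rpow_two, ← Real.rpow_mul hn'.le]
      congr 1
      field_simp
    have hmq : m ^ q = (n : ℝ) ^ (-(α * q / (2 * r))) := by
      rw [hm_def, ← Real.rpow_mul hn'.le]
      ring_nf
    have hX : K ^ 2 * (2 : ℝ) ^ (2 * r * (1 - (depthOf d s L₀ : ℝ))) / 288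
          * (n : ℝ) ^ (1 - α * (1 + B₁ / √(s : ℝ) + (B₂ - d) / s))
        = K ^ 2 * (m ^ (2 * r) * (2 : ℝ) ^ (2 * r * (1 - (depthOf d s L₀ : ℝ)))) / 288
          * (n : ℝ) ^ (1 - α * A) := by
      have e1 : m ^ (2 * r) = (n : ℝ) ^ (-α) := by
        rw [hm_def, ← Real.rpow_mul hn'.le]
        congr 1
        field_simp
      have e2 : (n : ℝ) ^ (1 - α * (1 + B₁ / √(s : ℝ) + (B₂ - d) / s))
          = (n : ℝ) ^ (-α) * (n : ℝ) ^ (1 - α * A) := by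
        rw [← Real.rpow_add hn', hA_def]
        ring_nf
      rw [e1, e2]
      ring
    have h1 := (hcore' m hm hm1).1
    have h2 := hlow m hm
    rw [hmq] at h2
    have h3 : 6 * ε ^ 2 / m ^ 2 = 6 * ε := by
      rw [hm2]
      field_simp
    have h4 := exp_exponent_le hn (y := α * d / s) hX.le (Real.exp_pos G) (Real.log_exp G).ge hnα
    rw [neg_mul]
    linarith
  · intro δ hδ hmargin _ g hg
    have hδ1 := hmargin.lt_one hρ hη
    have hu : 1 ≤ (n : ℝ) ^ (α * 1) * (δ / 2) ^ (-r) :=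
      one_le_mul_of_one_le_of_one_le hnα
        (Real.one_le_rpow_of_pos_of_le_one_of_nonpos (by positivity) (by linarith) (by linarith))
    have hX : K ^ 2 * (δ * (2 : ℝ) ^ (-(depthOf d s L₀ : ℝ))) ^ (2 * r) / 288
          * (n : ℝ) ^ (1 - α * A)
        ≤ K ^ 2 * (δ ^ (2 * r) * (2 : ℝ) ^ (2 * r * (1 - (depthOf d s L₀ : ℝ)))) / 288
          * (n : ℝ) ^ (1 - α * A) := by
      rw [Real.mul_rpow hδ.le (by positivity), ← Real.rpow_mul zero_le_two]
      have h2 : (2 : ℝ) ^ (-(depthOf d s L₀ : ℝ) * (2 * r))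
          ≤ (2 : ℝ) ^ (2 * r * (1 - (depthOf d s L₀ : ℝ))) :=
        Real.rpow_le_rpow_of_exponent_le one_le_two (by linarith)
      exact mul_le_mul_of_nonneg_right (div_le_div_of_nonneg_right (mul_le_mul_of_nonneg_left
        (mul_le_mul_of_nonneg_left h2 (by positivity)) (sq_nonneg K)) (by norm_num))
        (by positivity)
    have hlog : G ≤ Real.log g := by
      rcases hg with rfl | ⟨rfl, _⟩
      · rw [Real.log_exp]
        linarith [hT (N δ)]
      · rw [Real.log_exp]
    have hgpos : 0 < g := by
      rcases hg with rfl | ⟨rfl, _⟩ <;> exact Real.exp_pos _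
    rw [neg_mul, mul_assoc g]
    -- With `m = δ` the noise term vanishes and the Chebyshev term is `6ε²/δ²`, which is at most
    -- `6ε` exactly when `ε ≤ δ²`. Otherwise `g = Γ δ` and `n < N δ`, and the trivial bound applies.
    by_cases hεδ : ε ≤ δ ^ 2
    · have h1 := (hcore' δ hδ hδ1.le).1
      rw [hmargin.measureReal_eq_zero] at h1
      have h2 : 6 * ε ^ 2 / δ ^ 2 ≤ 6 * ε := by
        rw [div_le_iff₀ (by positivity)]
        nlinarith
      have h3 := exp_exponent_le hn (y := α * d / s) hX hgpos hlog hu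
      linarith
    · have hgΓ : g = Real.exp (G + T (N δ)) := by
        rcases hg with h | ⟨_, h⟩
        · exact h
        · exact absurd h hεδ
      have hnN : n < N δ := by
        by_contra hcon
        exact hεδ (hN δ hδ n (not_lt.1 hcon))
      have h1 := (hcore' δ hδ hδ1.le).2 (N δ) hnN
      have hlog' : T (N δ) ≤ Real.log g := by
        rw [hgΓ, Real.log_exp]
        linarith
      have h3 := exp_exponent_le hn (y := α * d / s) hX hgpos hlog' hu
      linarith
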